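/- Let $\sigma_0$ be the $2\times 2$ identity matrix and $\sigma_1,\sigma_2,\sigma_3$ the Pauli matrices $\sigma_x,\sigma_y,\sigma_z$. For a permutation $\pi$ of $\{1,\dots,n\}$ let $P_\pi$ be the operator on $(\mathbb{C}^2)^{\otimes n}$ that permutes the $n$ qubits by $\pi$, and put $\mathrm{Sym}(\rho)=\frac1{n!}\sum_\pi P_\pi\rho P_\pi^{-1}$. An $n$-qubit symmetric mixed state is a positive semidefinite operator $\rho$ on $(\mathbb{C}^2)^{\otimes n}$ of trace $1$ with $P_\pi\rho P_\pi^{-1}=\rho$ for all $\pi$. Let $F_n$ be the real-linear map from the space of Hermitian operators on $(\mathbb{C}^2)^{\otimes n}$ that are invariant under all permutations of the qubits to the space $\mathbb{R}_n[x,y,z]$ of real polynomials of degree at most $n$ that is determined by $$F_n\Big(\tfrac1{2^n}\,\mathrm{Sym}\big(\sigma_0^{\otimes n_0}\otimes\sigma_1^{\otimes n_1}\otimes\sigma_2^{\otimes n_2}\otimes\sigma_3^{\otimes n_3}\big)\Big)=x^{n_1}y^{n_2}z^{n_3}\qquad(n_0+n_1+n_2+n_3=n).$$ Let $\rho$ be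 an $n$-qubit symmetric mixed state. Then $g^{\otimes n}\rho\,(g^\dagger)^{\otimes n}=\rho$ for all $g\in SU(2)$ if and only if $F_n(\rho)$ is a real linear combination of the polynomials $(x^2+y^2+z^2)^m$ with $m$ an integer, $0\le m\le n/2$. Further, any two distinct such states are local unitarily inequivalent: if $\rho,\rho'$ are $n$-qubit symmetric mixed states, both invariant in this sense, and $g\rho g^\dagger=\rho'$ for some $g=g_1\otimes g_2\otimes\cdots\otimes g_n$ with each $g_i$ a $2\times 2$ unitary matrix, then $\rho=\rho'$. -/

import Mathlib

noncomputable section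

open scoped ComplexOrder

namespace SymWerner

/-- Operators on the Hilbert space of `n` qubits, as matrices in the computational basis
`|s⟩`, `s : Fin n → Fin 2`. -/
abbrev Op (n : ℕ) := Matrix (Fin n → Fin 2) (Fin n → Fin 2) ℂ

/-- The tensor product `A 0 ⊗ A 1 ⊗ ⋯ ⊗ A (n-1)` of one-qubit operators. -/
def tensor {n : ℕ} (A : Fin n → Matrix (Fin 2) (Fin 2) ℂ) : Op n :=
  Matrix.of fun s t => ∏ k, A k (s k) (t k)

/-- The identity and the Pauli matrices `σ_x`, `σ_y`, `σ_z`. -/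
def pauli : Fin 4 → Matrix (Fin 2) (Fin 2) ℂ :=
  ![!![1, 0; 0, 1], !![0, 1; 1, 0], !![0, -Complex.I; Complex.I, 0], !![1, 0; 0, -1]]

/-- `σ_I = σ_{i_1} ⊗ ⋯ ⊗ σ_{i_n}` for a multi-index `I`. -/
def pauliTensor {n : ℕ} (I : Fin n → Fin 4) : Op n := tensor fun k => pauli (I k)

/-- The operator `P_π` that permutes the qubits: the qubit at place `k` goes to place `π k`,
that is `P_π |s⟩ = |s ∘ π⁻¹⟩`. -/
def permOp {n : ℕ} (π : Equiv.Perm (Fin n)) : Op n :=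
  Matrix.of fun t s => if t = s ∘ ⇑π⁻¹ then 1 else 0

/-- The symmetrization operator. -/
def sym {n : ℕ} (ρ : Op n) : Op n :=
  ((n.factorial : ℝ)⁻¹) • ∑ π : Equiv.Perm (Fin n), permOp π * ρ * (permOp π)⁻¹

/-- The real vector space of Hermitian operators on `n` qubits that are invariant under
permutations of the qubits (the `n`-fold symmetric power of the space of `2 × 2` Hermitian
matrices). -/
def SymW (n : ℕ) : Submodule ℝ (Op n) where
  carrier := {ρ | ρ.IsHermitian ∧
    ∀ π : Equiv.Perm (Fin n), permOp π * ρ * (permOp π)⁻¹ = ρ}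
  add_mem' := by
    rintro a b ⟨ha, ha'⟩ ⟨hb, hb'⟩
    exact ⟨ha.add hb, fun π => by rw [mul_add, add_mul, ha', hb']⟩
  zero_mem' := ⟨Matrix.isHermitian_zero, fun π => by simp⟩
  smul_mem' := by
    rintro c a ⟨ha, ha'⟩
    refine ⟨?_, fun π => by rw [mul_smul_comm, smul_mul_assoc, ha']⟩
    rw [Matrix.IsHermitian, Matrix.conjTranspose_smul, ha.eq, star_trivial]

/-- Density matrices (mixed states). -/
def IsDensityMatrix {n : ℕ} (ρ : Op n) : Prop := ρ.PosSemidef ∧ ρ.trace = 1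

/-- Werner states: invariance under `g^{⊗ n} (·) (g†)^{⊗ n}` for all `g ∈ SU(2)`. -/
def IsWerner {n : ℕ} (ρ : Op n) : Prop :=
  ∀ g ∈ Matrix.specialUnitaryGroup (Fin 2) ℂ,
    tensor (fun _ : Fin n => g) * ρ * tensor (fun _ : Fin n => g.conjTranspose) = ρ

/-- The real coefficient `s_I` of `σ_I` in the expansion `ρ = ∑ I, s_I σ_I` of a Hermitian
operator (see `pauli_expansion` and `pauliCoeff_sum`). -/
def pauliCoeff {n : ℕ} (I : Fin n → Fin 4) (ρ : Op n) : ℝ :=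
  (2 ^ n : ℝ)⁻¹ * ((pauliTensor I * ρ).trace).re

/-- The monomial `x^{n₁} y^{n₂} z^{n₃}`, where `n_j` is the number of places at which `I` is
equal to `j`. -/
def pauliMonomial {n : ℕ} (I : Fin n → Fin 4) : MvPolynomial (Fin 3) ℝ :=
  ∏ k, (![1, MvPolynomial.X 0, MvPolynomial.X 1, MvPolynomial.X 2] :
    Fin 4 → MvPolynomial (Fin 3) ℝ) (I k)

/-- The linear extension to all operators of `2⁻ⁿ σ_I ↦ pauliMonomial I`. -/
def polyMap (n : ℕ) : Op n →ₗ[ℝ] MvPolynomial (Fin 3) ℝ where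
  toFun ρ := ∑ I : Fin n → Fin 4, (2 ^ n * pauliCoeff I ρ) • pauliMonomial I
  map_add' a b := by
    rw [← Finset.sum_add_distrib]
    refine Finset.sum_congr rfl fun I _ => ?_
    rw [← add_smul]
    congr 1
    simp only [pauliCoeff, mul_add, Matrix.trace_add, Complex.add_re]
  map_smul' c a := by
    rw [RingHom.id_apply, Finset.smul_sum]
    refine Finset.sum_congr rfl fun I _ => ?_
    rw [smul_smul]
    congr 1
    simp only [pauliCoeff, mul_smul_comm, Matrix.trace_smul, Complex.real_smul,
      Complex.re_ofReal_mul]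
    ring

theorem pauliMonomial_mem {n : ℕ} (I : Fin n → Fin 4) :
    pauliMonomial I ∈ MvPolynomial.restrictTotalDegree (Fin 3) ℝ n := by
  rw [MvPolynomial.mem_restrictTotalDegree]
  refine (MvPolynomial.totalDegree_finsetProd _ _).trans ?_
  refine (Finset.sum_le_card_nsmul _ _ 1 fun k _ => ?_).trans (by simp)
  generalize I k = j
  fin_cases j <;> simp

/-- The linear map `F_n` from symmetric Hermitian operators to real polynomials of degree at
most `n` in three variables.  It is the linear map with
`2⁻ⁿ Sym (σ₀^{⊗ n₀} ⊗ σ₁^{⊗ n₁} ⊗ σ₂^{⊗ n₂} ⊗ σ₃^{⊗ n₃}) ↦ x^{n₁} y^{n₂} z^{n₃}`: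
see `F_symPauli`, `pauliMonomial_append` and `F_unique`. -/
def F (n : ℕ) : SymW n →ₗ[ℝ] MvPolynomial.restrictTotalDegree (Fin 3) ℝ n :=
  ((polyMap n).comp (SymW n).subtype).codRestrict _ fun _ =>
    Submodule.sum_mem _ fun I _ => Submodule.smul_mem _ _ (pauliMonomial_mem I)

/-! Facts that identify the objects above. -/

theorem permOp_mul_permOp_inv {n : ℕ} (π : Equiv.Perm (Fin n)) :
    permOp π * permOp π⁻¹ = 1 := by
  ext s t
  rw [Matrix.mul_apply, Finset.sum_eq_single (t ∘ ⇑π)]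
  · simp [permOp, Matrix.one_apply, Function.comp_assoc]
  · intro u _ hu
    simp [permOp, hu]
  · simp

theorem permOp_inv {n : ℕ} (π : Equiv.Perm (Fin n)) : (permOp π)⁻¹ = permOp π⁻¹ :=
  Matrix.inv_eq_right_inv (permOp_mul_permOp_inv π)

theorem permOp_conj_apply {n : ℕ} (π : Equiv.Perm (Fin n)) (ρ : Op n) (s t : Fin n → Fin 2) :
    (permOp π * ρ * (permOp π)⁻¹) s t = ρ (s ∘ ⇑π) (t ∘ ⇑π) := by
  have h (s u : Fin n → Fin 2) : s = u ∘ ⇑π⁻¹ ↔ u = s ∘ ⇑π := by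
    constructor <;> rintro rfl <;> simp [Function.comp_assoc]
  rw [permOp_inv, Matrix.mul_apply, Finset.sum_eq_single (t ∘ ⇑π)]
  · rw [Matrix.mul_apply, Finset.sum_eq_single (s ∘ ⇑π)]
    · simp [permOp, Function.comp_assoc]
    · intro u _ hu
      simp only [permOp, Matrix.of_apply, h, hu, if_false, zero_mul]
    · simp
  · intro u _ hu
    simp [permOp, hu]
  · simp

theorem permOp_conj_pauliTensor {n : ℕ} (π : Equiv.Perm (Fin n)) (I : Fin n → Fin 4) :
    permOp π * pauliTensor I * (permOp π)⁻¹ = pauliTensor (I ∘ ⇑π⁻¹) := by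
  ext s t
  rw [permOp_conj_apply]
  simp only [pauliTensor, tensor, Matrix.of_apply, Function.comp_apply]
  rw [← Equiv.prod_comp π (fun k => pauli (I (π⁻¹ k)) (s k) (t k))]
  simp

theorem sym_mem {n : ℕ} {ρ : Op n} (hρ : ρ.IsHermitian) : sym ρ ∈ SymW n := by
  have key (s t : Fin n → Fin 2) : sym ρ s t =
      (n.factorial : ℝ)⁻¹ • ∑ π : Equiv.Perm (Fin n), ρ (s ∘ ⇑π) (t ∘ ⇑π) := by
    simp only [sym, Matrix.smul_apply, Matrix.sum_apply, permOp_conj_apply]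
  refine ⟨?_, fun τ => ?_⟩
  · ext s t
    rw [Matrix.conjTranspose_apply, key, key, star_smul, star_sum, star_trivial]
    congr 1
    exact Finset.sum_congr rfl fun π _ => hρ.apply _ _
  · ext s t
    rw [permOp_conj_apply, key, key]
    congr 1
    exact Equiv.sum_comp (Equiv.mulLeft τ) fun π => ρ (s ∘ ⇑π) (t ∘ ⇑π)

theorem sym_eq_self {n : ℕ} (ρ : SymW n) : sym (ρ : Op n) = ρ := by
  rw [sym, Finset.sum_congr rfl fun π _ => ρ.2.2 π, Finset.sum_const, Finset.card_univ,
    Fintype.card_perm, Fintype.card_fin, ← Nat.cast_smul_eq_nsmul ℝ, smul_smul,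
    inv_mul_cancel₀ (by positivity), one_smul]

theorem pauliTensor_isHermitian {n : ℕ} (I : Fin n → Fin 4) :
    (pauliTensor I).IsHermitian := by
  ext s t
  simp only [pauliTensor, tensor, Matrix.conjTranspose_apply, Matrix.of_apply, star_prod]
  refine Finset.prod_congr rfl fun k _ => ?_
  generalize I k = j
  generalize s k = a
  generalize t k = b
  fin_cases j <;> fin_cases a <;> fin_cases b <;> simp [pauli]

theorem trace_pauliTensor_mul {n : ℕ} (I J : Fin n → Fin 4) :
    (pauliTensor I * pauliTensor J).trace = if I = J then 2 ^ n else 0 := by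
  have h1 (i j : Fin 4) : ∑ p : Fin 2 × Fin 2, pauli i p.1 p.2 * pauli j p.2 p.1
      = if i = j then 2 else 0 := by
    rw [Fintype.sum_prod_type]
    fin_cases i <;> fin_cases j <;> simp [pauli] <;> norm_num
  have h2 : (pauliTensor I * pauliTensor J).trace =
      ∏ k, ∑ p : Fin 2 × Fin 2, pauli (I k) p.1 p.2 * pauli (J k) p.2 p.1 := by
    rw [Fintype.prod_sum]
    rw [← (Equiv.arrowProdEquivProdArrow (Fin n) (fun _ => Fin 2) (fun _ => Fin 2)).symm.sum_comp]
    simp only [Fintype.sum_prod_type, Matrix.trace, Matrix.diag_apply, Matrix.mul_apply,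
      pauliTensor, tensor, Matrix.of_apply, Finset.prod_mul_distrib]
    rfl
  rw [h2]
  simp only [h1]
  by_cases h : I = J
  · simp [h]
  · obtain ⟨k, hk⟩ := Function.ne_iff.mp h
    rw [if_neg h]
    exact Finset.prod_eq_zero (Finset.mem_univ k) (if_neg hk)

theorem pauliCoeff_pauliTensor {n : ℕ} (I J : Fin n → Fin 4) :
    pauliCoeff I (pauliTensor J) = if I = J then 1 else 0 := by
  rw [pauliCoeff, trace_pauliTensor_mul]
  split_ifs
  · have : ((2 : ℂ) ^ n).re = 2 ^ n := by exact_mod_cast Complex.ofReal_re ((2 : ℝ) ^ n)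
    rw [this, inv_mul_cancel₀ (by positivity)]
  · simp

/-- The coefficients in a Pauli expansion are unique. -/
theorem pauliCoeff_sum {n : ℕ} (r : (Fin n → Fin 4) → ℝ) (I : Fin n → Fin 4) :
    pauliCoeff I (∑ J, r J • pauliTensor J) = r I := by
  have : pauliCoeff I (∑ J, r J • pauliTensor J) =
      ∑ J, r J * pauliCoeff I (pauliTensor J) := by
    simp only [pauliCoeff, Finset.mul_sum, Matrix.trace_sum, Complex.re_sum, mul_smul_comm,
      Matrix.trace_smul, Complex.real_smul, Complex.re_ofReal_mul]
    exact Finset.sum_congr rfl fun _ _ => by ring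
  rw [this]
  simp [pauliCoeff_pauliTensor]

/-- Every Hermitian operator has a Pauli expansion with real coefficients. -/
theorem pauli_expansion {n : ℕ} {ρ : Op n} (hρ : ρ.IsHermitian) :
    ρ = ∑ I, pauliCoeff I ρ • pauliTensor I := by
  have h1 (a b c d : Fin 2) : ∑ j, pauli j a b * pauli j c d =
      if a = d ∧ b = c then 2 else 0 := by
    rw [Fin.sum_univ_four]
    fin_cases a <;> fin_cases b <;> fin_cases c <;> fin_cases d <;> simp [pauli] <;> norm_num
  have h2 (a b c d : Fin n → Fin 2) : ∑ I : Fin n → Fin 4, pauliTensor I a b * pauliTensor I c d =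
      if a = d ∧ b = c then 2 ^ n else 0 := by
    simp only [pauliTensor, tensor, Matrix.of_apply, ← Finset.prod_mul_distrib]
    rw [← Fintype.prod_sum fun k j => pauli j (a k) (b k) * pauli j (c k) (d k)]
    simp only [h1]
    by_cases h : a = d ∧ b = c
    · simp [h.1, h.2]
    · rw [if_neg h]
      have : ∃ k, ¬ (a k = d k ∧ b k = c k) := by
        by_contra hc
        push Not at hc
        exact h ⟨funext fun k => (hc k).1, funext fun k => (hc k).2⟩
      obtain ⟨k, hk⟩ := this
      exact Finset.prod_eq_zero (Finset.mem_univ k) (if_neg hk)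
  have h3 (I : Fin n → Fin 4) : ((pauliCoeff I ρ : ℝ) : ℂ) =
      (2 ^ n : ℂ)⁻¹ * (pauliTensor I * ρ).trace := by
    have : star ((pauliTensor I * ρ).trace) = (pauliTensor I * ρ).trace := by
      rw [← Matrix.trace_conjTranspose, Matrix.conjTranspose_mul, hρ.eq,
        (pauliTensor_isHermitian I).eq, Matrix.trace_mul_comm]
    rw [pauliCoeff]
    push_cast
    rw [Complex.conj_eq_iff_re.mp this]
  ext s t
  simp only [Matrix.sum_apply, Matrix.smul_apply, Complex.real_smul, h3, Matrix.trace,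
    Matrix.diag_apply, Matrix.mul_apply, Finset.mul_sum, Finset.sum_mul]
  rw [Finset.sum_comm]
  have h4 (a : Fin n → Fin 2) : ∑ I : Fin n → Fin 4, ∑ b, (2 ^ n : ℂ)⁻¹ *
      (pauliTensor I a b * ρ b a) * pauliTensor I s t =
      ∑ b, if a = t ∧ b = s then ρ b a else 0 := by
    rw [Finset.sum_comm]
    refine Finset.sum_congr rfl fun b _ => ?_
    have : ∑ I : Fin n → Fin 4, (2 ^ n : ℂ)⁻¹ *
        (pauliTensor I a b * ρ b a) * pauliTensor I s t =
        (2 ^ n : ℂ)⁻¹ * ρ b a * ∑ I : Fin n → Fin 4, pauliTensor I a b * pauliTensor I s t := by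
      rw [Finset.mul_sum]
      exact Finset.sum_congr rfl fun _ _ => by ring
    rw [this, h2]
    split_ifs
    · field_simp
    · simp
  simp only [h4]
  rw [Finset.sum_eq_single t, Finset.sum_eq_single s] <;> simp +contextual

/-- The element `2⁻ⁿ Sym (σ_I)`. -/
def symPauli {n : ℕ} (I : Fin n → Fin 4) : SymW n :=
  (2 ^ n : ℝ)⁻¹ • ⟨sym (pauliTensor I), sym_mem (pauliTensor_isHermitian I)⟩

theorem F_symPauli {n : ℕ} (I : Fin n → Fin 4) :
    (F n (symPauli I) : MvPolynomial (Fin 3) ℝ) = pauliMonomial I := by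
  have h1 (J : Fin n → Fin 4) :
      polyMap n (pauliTensor J) = (2 ^ n : ℝ) • pauliMonomial J := by
    simp [polyMap, pauliCoeff_pauliTensor]
  have h2 (π : Equiv.Perm (Fin n)) : pauliMonomial (I ∘ ⇑π) = pauliMonomial I :=
    Equiv.prod_comp π fun k => (![1, MvPolynomial.X 0, MvPolynomial.X 1, MvPolynomial.X 2] :
      Fin 4 → MvPolynomial (Fin 3) ℝ) (I k)
  change polyMap n ((2 ^ n : ℝ)⁻¹ • sym (pauliTensor I)) = _
  rw [map_smul, sym, map_smul, map_sum]
  simp only [permOp_conj_pauliTensor, h1, h2]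
  rw [Finset.sum_const, Finset.card_univ, Fintype.card_perm, Fintype.card_fin,
    ← Nat.cast_smul_eq_nsmul ℝ, smul_smul, smul_smul, smul_smul]
  have : (n.factorial : ℝ) ≠ 0 := by positivity
  rw [show (2 ^ n : ℝ)⁻¹ * (n.factorial : ℝ)⁻¹ * n.factorial * 2 ^ n = 1 by field_simp,
    one_smul]

theorem pauliMonomial_append (n₀ n₁ n₂ n₃ : ℕ) :
    pauliMonomial (Fin.append (Fin.append (Fin.append (fun _ : Fin n₀ => (0 : Fin 4))
      (fun _ : Fin n₁ => 1)) (fun _ : Fin n₂ => 2)) (fun _ : Fin n₃ => 3)) =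
    MvPolynomial.X 0 ^ n₁ * MvPolynomial.X 1 ^ n₂ * MvPolynomial.X 2 ^ n₃ := by
  simp [pauliMonomial, Fin.prod_univ_add]

/-- `F n` is determined by its values on the elements `2⁻ⁿ Sym (σ_I)`. -/
theorem F_unique {n : ℕ} (L : SymW n →ₗ[ℝ] MvPolynomial.restrictTotalDegree (Fin 3) ℝ n)
    (hL : ∀ I : Fin n → Fin 4,
      (L (symPauli I) : MvPolynomial (Fin 3) ℝ) = pauliMonomial I) : L = F n := by
  ext1 ρ
  have h : ρ = ∑ I : Fin n → Fin 4, (2 ^ n * pauliCoeff I (ρ : Op n)) • symPauli I := by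
    apply Subtype.ext
    conv_lhs => rw [← sym_eq_self ρ, pauli_expansion ρ.2.1]
    simp only [sym, symPauli, Finset.mul_sum, Finset.sum_mul, mul_smul_comm, smul_mul_assoc,
      Submodule.coe_sum, Submodule.coe_smul]
    rw [Finset.sum_comm, Finset.smul_sum]
    refine Finset.sum_congr rfl fun I _ => ?_
    rw [← Finset.smul_sum, smul_smul, smul_smul, smul_smul]
    congr 1
    field_simp
  rw [h, map_sum, map_sum]
  refine Finset.sum_congr rfl fun I _ => ?_
  rw [map_smul, map_smul]
  congr 1
  exact Subtype.ext ((hL I).trans (F_symPauli I).symm)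

end SymWerner

end

/-!
# Symmetric Werner states

The expectation `tr (ρ · A 0 ⊗ ⋯ ⊗ A (n-1))` is a multilinear function `expect ρ` of the `A k`, and
`F n ρ` is the polynomial function `v ↦ expect ρ (1 + v · σ, …, 1 + v · σ)` on `ℝ³` (`eval_F`).
Conjugation by `g ∈ SU(2)` rotates `v`.

*The polynomials.*  If `ρ` is a Werner state, then `F n ρ` is constant on spheres, because `SU(2)`
acts transitively on them (`exists_specialUnitary_bloch`), and such a polynomial is a polynomial in
`x² + y² + z²` (`exists_eq_sum_of_eval_eq`).  Conversely, if `F n ρ` is of this form, then `ρ` and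
its conjugate by `g^{⊗ n}` have the same polynomial, and they are equal because `F n` is injective
(`F_injective`).

*Local unitary inequivalence.*  Let `g` be a local unitary that takes `ρ` to `ρ'`.  Transitivity on
spheres gives `⟨v · σ on S⟩ = |v|^{|S|} ⟨σ_z on S⟩` for each set `S` of qubits.  If all the
`⟨σ_z on S⟩` with `S` nonempty are zero, then `ρ` is maximally mixed and is fixed by `g`.
Otherwise one of them, with `|S| = 2m > 0`, is nonzero, and by symmetry `S` may be taken to contain
any two given qubits `i` and `j`.  Polarization (`IsWerner.expect_two`) yields, for `|v| = 1`,
`(2m - 1) ⟨x · σ at i, y · σ at j, v · σ on the rest of S⟩ =`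
`⟨σ_z on S⟩ (x · y + (2m - 2) (v · x) (v · y))`.
Let `R` be the rotation by `(g i)† (g j)`.
* For `m = 1`, comparison of the two-qubit correlations of `ρ` and `ρ'` shows that `R` is a scalar
  (`exists_smul_of_card_eq_two`).
* For `m ≥ 2`, `ρ` is invariant under `R` on the qubit `i` and `R⁻¹` on the qubit `j`, because `ρ'`
  is invariant under the exchange of the two.  The formula then forces `v · R v = ±1` for
  all unit vectors `v`, so `R` fixes all axes and is a scalar (`exists_smul_of_two_lt_card`).
A rotation that is a scalar is trivial (`eq_smul_one_of_bloch_conj`).  So all the `g k` agree up to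
scalars, `g` acts like `h^{⊗ n}` with `h ∈ SU(2)`, and `ρ' = ρ`.
-/

open scoped ComplexOrder

namespace SymWerner

open Matrix

/-! ### Conjugation of the matrices `v · σ` -/

/-- The one-qubit operator `v · σ = v₀ σ_x + v₁ σ_y + v₂ σ_z`. -/
def bloch (v : Fin 3 → ℝ) : Matrix (Fin 2) (Fin 2) ℂ :=
  !![(v 2 : ℂ), v 0 - Complex.I * v 1; v 0 + Complex.I * v 1, -v 2]

theorem bloch_add (v w : Fin 3 → ℝ) : bloch (v + w) = bloch v + bloch w := by
  ext a b
  fin_cases a <;> fin_cases b <;> simp [bloch] <;> ring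

theorem bloch_smul (r : ℝ) (v : Fin 3 → ℝ) : bloch (r • v) = (r : ℂ) • bloch v := by
  ext a b
  fin_cases a <;> fin_cases b <;> simp [bloch] <;> ring

theorem bloch_conjTranspose (v : Fin 3 → ℝ) : (bloch v)ᴴ = bloch v := by
  ext a b
  fin_cases a <;> fin_cases b <;> simp [bloch, Matrix.conjTranspose_apply, sub_eq_add_neg]

theorem bloch_mul_self (v : Fin 3 → ℝ) : bloch v * bloch v = ((v ⬝ᵥ v : ℝ) : ℂ) • 1 := by
  ext a b
  fin_cases a <;> fin_cases b <;>
    simp [bloch, Matrix.mul_apply, dotProduct, Fin.sum_univ_three] <;>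
    first | ring1 | linear_combination (-(v 1 : ℂ) ^ 2) * Complex.I_sq

theorem bloch_det (v : Fin 3 → ℝ) : (bloch v).det = -((v ⬝ᵥ v : ℝ) : ℂ) := by
  simp [bloch, Matrix.det_fin_two, dotProduct, Fin.sum_univ_three]
  linear_combination ((v 1 : ℂ) ^ 2) * Complex.I_sq

theorem bloch_trace_mul (v w : Fin 3 → ℝ) :
    (bloch v * bloch w).trace = 2 * ((v ⬝ᵥ w : ℝ) : ℂ) := by
  simp [bloch, Matrix.trace, dotProduct, Fin.sum_univ_three, Fin.sum_univ_two]
  linear_combination (-2 * (v 1 : ℂ) * w 1) * Complex.I_sq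

theorem bloch_injective : Function.Injective bloch := by
  intro v w h
  have h00 := congrFun (congrFun h 0) 0
  have h01 := congrFun (congrFun h 0) 1
  have h0 : (v 0 : ℝ) = w 0 := by simpa [bloch] using congrArg Complex.re h01
  have h1 : (v 1 : ℝ) = w 1 := by simpa [bloch] using congrArg Complex.im h01
  have h2 : (v 2 : ℝ) = w 2 := by simpa [bloch] using h00
  funext k
  fin_cases k <;> assumption

/-- Traceless Hermitian `2 × 2` matrices are of the form `v · σ`. -/
theorem exists_bloch {M : Matrix (Fin 2) (Fin 2) ℂ} (hM : M.IsHermitian) (ht : M.trace = 0) :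
    ∃ v, M = bloch v := by
  refine ⟨![(M 0 1).re, -(M 0 1).im, (M 0 0).re], ?_⟩
  have h10 : M 1 0 = star (M 0 1) := (hM.apply 1 0).symm
  have h00 : (((M 0 0).re : ℝ) : ℂ) = M 0 0 := Complex.conj_eq_iff_re.mp (hM.apply 0 0)
  have h11 : M 1 1 = -M 0 0 := by
    rw [Matrix.trace_fin_two] at ht
    linear_combination ht
  have h01 : M 0 1 = (M 0 1).re + (M 0 1).im * Complex.I := (Complex.re_add_im _).symm
  ext a b
  fin_cases a <;> fin_cases b
  · simp [bloch, h00]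
  · simp only [bloch]
    simp
    linear_combination h01
  · simp only [bloch]
    simp [h10, Complex.ext_iff]
  · simp [bloch, h00, h11]

/-- Conjugation by a unitary matrix acts on the vectors `v` by an isometry. -/
theorem exists_bloch_conj {A : Matrix (Fin 2) (Fin 2) ℂ} (hA : A ∈ unitaryGroup (Fin 2) ℂ)
    (v : Fin 3 → ℝ) : ∃ w, A * bloch v * Aᴴ = bloch w := by
  refine exists_bloch ?_ ?_
  · rw [Matrix.IsHermitian, Matrix.conjTranspose_mul, Matrix.conjTranspose_mul,
      bloch_conjTranspose, Matrix.conjTranspose_conjTranspose, Matrix.mul_assoc]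
  · have h : Aᴴ * A = 1 := mem_unitaryGroup_iff'.mp hA
    rw [Matrix.trace_mul_comm, ← Matrix.mul_assoc, h, Matrix.one_mul]
    simp [bloch, Matrix.trace_fin_two]

theorem dotProduct_of_bloch_conj {A : Matrix (Fin 2) (Fin 2) ℂ}
    (hA : A ∈ unitaryGroup (Fin 2) ℂ) {v w v' w' : Fin 3 → ℝ}
    (hv : A * bloch v * Aᴴ = bloch v') (hw : A * bloch w * Aᴴ = bloch w') :
    v' ⬝ᵥ w' = v ⬝ᵥ w := by
  have h : Aᴴ * A = 1 := mem_unitaryGroup_iff'.mp hA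
  have h2 : bloch v' * bloch w' = A * (bloch v * bloch w) * Aᴴ := by
    rw [← hv, ← hw]
    calc A * bloch v * Aᴴ * (A * bloch w * Aᴴ)
        = A * bloch v * (Aᴴ * A) * bloch w * Aᴴ := by simp only [Matrix.mul_assoc]
      _ = _ := by rw [h, Matrix.mul_one]; simp only [Matrix.mul_assoc]
  have h3 := congrArg Matrix.trace h2
  rw [Matrix.trace_mul_comm (A * _), ← Matrix.mul_assoc Aᴴ, h, Matrix.one_mul,
    bloch_trace_mul, bloch_trace_mul] at h3
  exact_mod_cast mul_left_cancel₀ two_ne_zero h3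

theorem bloch_mul_mul (m v : Fin 3 → ℝ) :
    bloch m * bloch v * bloch m = bloch ((2 * (m ⬝ᵥ v)) • m - (m ⬝ᵥ m) • v) := by
  have h : bloch m * bloch v + bloch v * bloch m = ((2 * (m ⬝ᵥ v) : ℝ) : ℂ) • 1 := by
    have h1 := bloch_mul_self (m + v)
    have h2 : (m + v) ⬝ᵥ (m + v) = m ⬝ᵥ m + 2 * (m ⬝ᵥ v) + v ⬝ᵥ v := by
      rw [add_dotProduct, dotProduct_add, dotProduct_add, dotProduct_comm v m]
      ring
    rw [bloch_add, h2, add_mul, mul_add, mul_add, bloch_mul_self, bloch_mul_self] at h1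
    rw [Complex.ofReal_add, Complex.ofReal_add, add_smul, add_smul] at h1
    rw [← sub_eq_zero] at h1 ⊢
    rw [← h1]
    abel
  have h3 : bloch m * bloch v = ((2 * (m ⬝ᵥ v) : ℝ) : ℂ) • 1 - bloch v * bloch m :=
    eq_sub_of_add_eq h
  rw [h3, sub_mul, Matrix.mul_assoc, bloch_mul_self, sub_eq_add_neg, sub_eq_add_neg,
    ← neg_smul, bloch_add, bloch_smul, bloch_smul]
  simp

theorem I_smul_bloch_mem {m : Fin 3 → ℝ} (hm : m ⬝ᵥ m = 1) :
    Complex.I • bloch m ∈ specialUnitaryGroup (Fin 2) ℂ := by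
  rw [mem_specialUnitaryGroup_iff]
  constructor
  · rw [mem_unitaryGroup_iff, star_smul, Matrix.star_eq_conjTranspose, bloch_conjTranspose,
      smul_mul_smul_comm, bloch_mul_self, hm]
    simp
  · rw [Matrix.det_smul, bloch_det, hm]
    simp

/-- `SU(2)` acts transitively on spheres: if `|v|² = r²` then some `g ∈ SU(2)` takes `v` to
`(0, 0, r)`. -/
theorem exists_specialUnitary_bloch {v : Fin 3 → ℝ} {r : ℝ} (h : v ⬝ᵥ v = r ^ 2) :
    ∃ g ∈ specialUnitaryGroup (Fin 2) ℂ, g * bloch v * gᴴ = bloch ![0, 0, r] := by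
  -- The half-turn about the bisector `m` of `v` and `(0, 0, r)`, or about the first axis if
  -- these two vectors are opposite.
  suffices ∃ m : Fin 3 → ℝ, m ⬝ᵥ m = 1 ∧ (2 * (m ⬝ᵥ v)) • m - v = ![0, 0, r] by
    obtain ⟨m, hm, hv⟩ := this
    refine ⟨_, I_smul_bloch_mem hm, ?_⟩
    rw [Matrix.conjTranspose_smul, bloch_conjTranspose, smul_mul_assoc, smul_mul_smul_comm,
      bloch_mul_mul, hm, one_smul, hv]
    simp
  set u : Fin 3 → ℝ := v + ![0, 0, r] with hu
  have huu : u ⬝ᵥ u = 2 * (u ⬝ᵥ v) := by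
    simp only [hu, dotProduct, Fin.sum_univ_three, Pi.add_apply, Matrix.cons_val_zero,
      Matrix.cons_val_one, Matrix.cons_val] at h ⊢
    linear_combination -h
  by_cases h0 : u = 0
  · refine ⟨![1, 0, 0], by simp [dotProduct, Fin.sum_univ_three], ?_⟩
    have h1 : v = -![0, 0, r] := eq_neg_of_add_eq_zero_left h0
    rw [h1]
    ext k
    fin_cases k <;> simp [dotProduct, Fin.sum_univ_three]
  · have hpos : 0 < u ⬝ᵥ u :=
      lt_of_le_of_ne (Finset.sum_nonneg fun _ _ => mul_self_nonneg _)
        fun h => h0 (dotProduct_self_eq_zero.mp h.symm)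
    have hs : √(u ⬝ᵥ u) * √(u ⬝ᵥ u) = u ⬝ᵥ u := Real.mul_self_sqrt hpos.le
    have hs0 : √(u ⬝ᵥ u) ≠ 0 := (Real.sqrt_pos.mpr hpos).ne'
    refine ⟨(√(u ⬝ᵥ u))⁻¹ • u, ?_, ?_⟩
    · rw [smul_dotProduct, dotProduct_smul, smul_eq_mul, smul_eq_mul]
      field_simp
      rw [sq, hs]
    · rw [smul_dotProduct, smul_smul, smul_eq_mul,
        show 2 * ((√(u ⬝ᵥ u))⁻¹ * (u ⬝ᵥ v)) * (√(u ⬝ᵥ u))⁻¹ =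
          (√(u ⬝ᵥ u) * √(u ⬝ᵥ u))⁻¹ * (2 * (u ⬝ᵥ v)) by rw [mul_inv]; ring, hs, ← huu,
        inv_mul_cancel₀ hpos.ne', one_smul, hu]
      abel

/-- A unitary matrix that acts on all the `v · σ` by one scalar is itself a scalar matrix.  The
scalar is forced to be `1` by `σ_x σ_y = i σ_z`. -/
theorem eq_smul_one_of_bloch_conj {A : Matrix (Fin 2) (Fin 2) ℂ}
    (hA : A ∈ unitaryGroup (Fin 2) ℂ) {ε : ℂ} (h : ∀ v, A * bloch v * Aᴴ = ε • bloch v) :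
    ∃ z : ℂ, A = z • 1 := by
  have hA' : Aᴴ * A = 1 := mem_unitaryGroup_iff'.mp hA
  have hxy : bloch ![1, 0, 0] * bloch ![0, 1, 0] = Complex.I • bloch ![0, 0, 1] := by
    ext a b
    fin_cases a <;> fin_cases b <;> simp [bloch, Matrix.mul_apply]
  have h1 : (ε * ε) • (Complex.I • bloch ![0, 0, 1]) = ε • (Complex.I • bloch ![0, 0, 1]) := by
    calc (ε * ε) • (Complex.I • bloch ![0, 0, 1])
        = (A * bloch ![1, 0, 0] * Aᴴ) * (A * bloch ![0, 1, 0] * Aᴴ) := by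
          rw [h, h, smul_mul_smul_comm, hxy]
      _ = A * bloch ![1, 0, 0] * (Aᴴ * A) * bloch ![0, 1, 0] * Aᴴ := by
          simp only [Matrix.mul_assoc]
      _ = A * (bloch ![1, 0, 0] * bloch ![0, 1, 0]) * Aᴴ := by
          rw [hA', Matrix.mul_one]; simp only [Matrix.mul_assoc]
      _ = ε • (Complex.I • bloch ![0, 0, 1]) := by
          rw [hxy, mul_smul_comm, smul_mul_assoc, h, smul_comm]
  have h2 : ε * ε = ε := by
    have := congrFun (congrFun h1 0) 0
    simpa [bloch] using this
  have hc (v) : A * bloch v = ε • (bloch v * A) := by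
    rw [← smul_mul_assoc, ← h v, Matrix.mul_assoc, hA', Matrix.mul_one]
  have h3 : ε = 1 := by
    rcases mul_eq_zero.mp (show ε * (ε - 1) = 0 by linear_combination h2) with h0 | h0
    · exfalso
      have h4 := congrArg (fun M => Aᴴ * M) (hc ![0, 0, 1])
      simp only [h0, zero_smul, Matrix.mul_zero, ← Matrix.mul_assoc, hA', Matrix.one_mul] at h4
      have := congrFun (congrFun h4 0) 0
      simp [bloch] at this
    · exact sub_eq_zero.mp h0
  subst h3
  have hz := hc ![0, 0, 1]
  have hx := hc ![1, 0, 0]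
  rw [one_smul] at hz hx
  have e01 : A 0 1 = 0 := by
    have := congrFun (congrFun hz 0) 1
    simp [bloch, Matrix.mul_apply] at this
    exact self_eq_neg.mp this.symm
  have e10 : A 1 0 = 0 := by
    have := congrFun (congrFun hz 1) 0
    simp [bloch, Matrix.mul_apply] at this
    exact self_eq_neg.mp this
  have e11 : A 1 1 = A 0 0 := by
    have := congrFun (congrFun hx 0) 1
    simp [bloch, Matrix.mul_apply] at this
    exact this.symm
  refine ⟨A 0 0, ?_⟩
  ext a b
  fin_cases a <;> fin_cases b <;> simp [e01, e10, e11]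

/-- A matrix that fixes every axis acts on all the `v · σ` by one scalar. -/
theorem exists_smul_of_forall_bloch_conj {A : Matrix (Fin 2) (Fin 2) ℂ}
    (h : ∀ v : Fin 3 → ℝ, v ⬝ᵥ v = 1 → ∃ s : ℝ, A * bloch v * Aᴴ = bloch (s • v)) :
    ∃ ε : ℂ, ∀ v, A * bloch v * Aᴴ = ε • bloch v := by
  have key (v : Fin 3 → ℝ) : ∃ s : ℝ, A * bloch v * Aᴴ = bloch (s • v) := by
    by_cases h0 : v = 0
    · have : bloch 0 = 0 := by simpa using bloch_smul 0 0
      simp [h0, this]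
    have hpos : 0 < v ⬝ᵥ v :=
      lt_of_le_of_ne (Finset.sum_nonneg fun _ _ => mul_self_nonneg _)
        fun h => h0 (dotProduct_self_eq_zero.mp h.symm)
    have hs : √(v ⬝ᵥ v) * √(v ⬝ᵥ v) = v ⬝ᵥ v := Real.mul_self_sqrt hpos.le
    have hs0 : √(v ⬝ᵥ v) ≠ 0 := (Real.sqrt_pos.mpr hpos).ne'
    have hv : v = √(v ⬝ᵥ v) • ((√(v ⬝ᵥ v))⁻¹ • v) := by
      rw [smul_smul, mul_inv_cancel₀ hs0, one_smul]
    obtain ⟨s, h1⟩ := h ((√(v ⬝ᵥ v))⁻¹ • v) (by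
      rw [smul_dotProduct, dotProduct_smul, smul_eq_mul, smul_eq_mul]
      field_simp
      rw [sq, hs])
    refine ⟨s, ?_⟩
    rw [hv, bloch_smul √(v ⬝ᵥ v), mul_smul_comm, smul_mul_assoc, smul_comm s, h1,
      bloch_smul √(v ⬝ᵥ v)]
  obtain ⟨a, ha⟩ := key ![1, 0, 0]
  obtain ⟨b, hb⟩ := key ![0, 1, 0]
  obtain ⟨c, hc⟩ := key ![0, 0, 1]
  -- The three scalars agree because the axis of `(1, 1, 1)` is fixed too.
  obtain ⟨s, hs⟩ := key (![1, 0, 0] + ![0, 1, 0] + ![0, 0, 1])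
  have h1 := hs
  rw [bloch_add, bloch_add, mul_add, mul_add, add_mul, add_mul, ha, hb, hc, ← bloch_add,
    ← bloch_add] at h1
  have h2 := bloch_injective h1
  obtain rfl : a = s := by simpa using congrFun h2 0
  obtain rfl : b = a := by simpa using congrFun h2 1
  obtain rfl : c = b := by simpa using congrFun h2 2
  refine ⟨c, fun v => ?_⟩
  have hv : bloch v = (v 0 : ℂ) • bloch ![1, 0, 0] + (v 1 : ℂ) • bloch ![0, 1, 0]
      + (v 2 : ℂ) • bloch ![0, 0, 1] := by
    rw [← bloch_smul, ← bloch_smul, ← bloch_smul, ← bloch_add, ← bloch_add]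
    congr 1
    ext k
    fin_cases k <;> simp
  rw [hv, mul_add, mul_add, add_mul, add_mul, mul_smul_comm, mul_smul_comm, mul_smul_comm,
    smul_mul_assoc, smul_mul_assoc, smul_mul_assoc, ha, hb, hc, bloch_smul, bloch_smul,
    bloch_smul, smul_add, smul_add, smul_comm (c : ℂ), smul_comm (c : ℂ), smul_comm (c : ℂ)]

/-! ### Expectations of product observables and the injectivity of `F` -/

section

open MvPolynomial

theorem tensor_mul_tensor {n : ℕ} (A B : Fin n → Matrix (Fin 2) (Fin 2) ℂ) :
    tensor A * tensor B = tensor fun k => A k * B k := by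
  ext s t
  simp only [tensor, Matrix.mul_apply, Matrix.of_apply, ← Finset.prod_mul_distrib]
  exact (Fintype.prod_sum fun k j => A k (s k) j * B k j (t k)).symm

theorem tensor_conjTranspose {n : ℕ} (A : Fin n → Matrix (Fin 2) (Fin 2) ℂ) :
    (tensor A)ᴴ = tensor fun k => (A k)ᴴ := by
  ext s t
  simp [tensor, Matrix.conjTranspose_apply]

theorem tensor_one {n : ℕ} : tensor (fun _ : Fin n => (1 : Matrix (Fin 2) (Fin 2) ℂ)) = 1 := by
  ext s t
  simp only [tensor, Matrix.of_apply, Matrix.one_apply]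
  by_cases h : s = t
  · simp [h]
  · obtain ⟨k, hk⟩ := Function.ne_iff.mp h
    rw [if_neg h]
    exact Finset.prod_eq_zero (Finset.mem_univ k) (if_neg hk)

theorem tensor_smul {n : ℕ} (z : Fin n → ℂ) (A : Fin n → Matrix (Fin 2) (Fin 2) ℂ) :
    tensor (fun k => z k • A k) = (∏ k, z k) • tensor A := by
  ext s t
  simp [tensor, Finset.prod_mul_distrib]

theorem permOp_conj_tensor {n : ℕ} (π : Equiv.Perm (Fin n))
    (A : Fin n → Matrix (Fin 2) (Fin 2) ℂ) :
    permOp π * tensor A * (permOp π)⁻¹ = tensor (A ∘ ⇑π⁻¹) := by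
  ext s t
  rw [permOp_conj_apply]
  simp only [tensor, Matrix.of_apply, Function.comp_apply]
  rw [← Equiv.prod_comp π (fun k => A (π⁻¹ k) (s k) (t k))]
  simp

theorem permOp_inv_mul_permOp {n : ℕ} (π : Equiv.Perm (Fin n)) :
    (permOp π)⁻¹ * permOp π = 1 := by
  have := permOp_mul_permOp_inv π⁻¹
  rwa [inv_inv, ← permOp_inv] at this

/-- The expectation `tr (ρ · A 0 ⊗ ⋯ ⊗ A (n-1))` of a product observable, as a multilinear
function of its factors. -/
noncomputable def expect {n : ℕ} (ρ : Op n) :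
    MultilinearMap ℂ (fun _ : Fin n => Matrix (Fin 2) (Fin 2) ℂ) ℂ :=
  ∑ s : Fin n → Fin 2, ∑ t : Fin n → Fin 2, ρ s t •
    (MultilinearMap.mkPiAlgebra ℂ (Fin n) ℂ).compLinearMap fun k =>
      Matrix.entryLinearMap ℂ ℂ (t k) (s k)

theorem expect_apply {n : ℕ} (ρ : Op n) (A : Fin n → Matrix (Fin 2) (Fin 2) ℂ) :
    expect ρ A = (ρ * tensor A).trace := by
  simp [expect, Matrix.trace, Matrix.mul_apply, tensor]

theorem expect_conj {n : ℕ} (ρ : Op n) (g A : Fin n → Matrix (Fin 2) (Fin 2) ℂ) :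
    expect (tensor g * ρ * (tensor g)ᴴ) A = expect ρ fun k => (g k)ᴴ * A k * g k := by
  rw [expect_apply, expect_apply, Matrix.mul_assoc, Matrix.mul_assoc, Matrix.trace_mul_comm,
    tensor_conjTranspose, Matrix.mul_assoc, tensor_mul_tensor, tensor_mul_tensor]

theorem expect_comp_perm {n : ℕ} (ρ : SymW n) (π : Equiv.Perm (Fin n))
    (A : Fin n → Matrix (Fin 2) (Fin 2) ℂ) :
    expect (ρ : Op n) (A ∘ ⇑π) = expect (ρ : Op n) A := by
  have h : tensor (A ∘ ⇑π) = (permOp π)⁻¹ * tensor A * permOp π := by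
    have := permOp_conj_tensor π⁻¹ A
    rw [inv_inv, permOp_inv, inv_inv, ← permOp_inv] at this
    exact this.symm
  rw [expect_apply, expect_apply, h, Matrix.trace_mul_comm, Matrix.mul_assoc, Matrix.mul_assoc,
    Matrix.trace_mul_comm]
  conv_rhs => rw [Matrix.trace_mul_comm, ← ρ.2.2 π]
  simp only [Matrix.mul_assoc]

/-- Two colourings with equally many points of each colour differ by a permutation. -/
theorem exists_perm_of_card_eq {α γ : Type*} [Fintype α] [DecidableEq γ] {f g : α → γ}
    (h : ∀ c, Fintype.card {a // f a = c} = Fintype.card {a // g a = c}) :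
    ∃ π : Equiv.Perm α, g ∘ ⇑π = f :=
  ⟨Equiv.ofFiberEquiv fun c => Fintype.equivOfCardEq (h c),
    funext fun a => Equiv.ofFiberEquiv_map _ a⟩

/-- The exponents of the monomial `pauliMonomial I`. -/
noncomputable def pauliDegree {n : ℕ} (I : Fin n → Fin 4) : Fin 3 →₀ ℕ :=
  ∑ k, (![0, Finsupp.single 0 1, Finsupp.single 1 1, Finsupp.single 2 1] :
    Fin 4 → Fin 3 →₀ ℕ) (I k)

theorem pauliMonomial_eq {n : ℕ} (I : Fin n → Fin 4) :
    pauliMonomial I = monomial (pauliDegree I) 1 := by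
  rw [pauliDegree, monomial_sum_index, C_1, one_mul, pauliMonomial]
  refine Finset.prod_congr rfl fun k _ => ?_
  generalize I k = j
  fin_cases j <;> simp [X]

theorem pauliDegree_apply {n : ℕ} (I : Fin n → Fin 4) (i : Fin 3) :
    pauliDegree I i = Fintype.card {k // I k = i.succ} := by
  rw [Fintype.card_subtype, Finset.card_filter, pauliDegree, Finsupp.finsetSum_apply]
  refine Finset.sum_congr rfl fun k _ => ?_
  generalize I k = j
  fin_cases j <;> fin_cases i <;> simp +decide

theorem card_eq_of_pauliDegree_eq {n : ℕ} {I J : Fin n → Fin 4}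
    (h : pauliDegree I = pauliDegree J) (c : Fin 4) :
    Fintype.card {k // I k = c} = Fintype.card {k // J k = c} := by
  have hs (i : Fin 3) : Fintype.card {k // I k = i.succ} = Fintype.card {k // J k = i.succ} := by
    rw [← pauliDegree_apply, ← pauliDegree_apply, h]
  have hn (K : Fin n → Fin 4) : Fintype.card {k // K k = 0} +
      ∑ i : Fin 3, Fintype.card {k // K k = i.succ} = n := by
    rw [← Fin.sum_univ_succ fun c => Fintype.card {k // K k = c}, ← Fintype.card_sigma,
      Fintype.card_congr (Equiv.sigmaFiberEquiv K), Fintype.card_fin]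
  refine Fin.cases ?_ hs c
  have hI := hn I
  have hJ := hn J
  simp only [hs] at hI
  omega

theorem pauliCoeff_comp_perm {n : ℕ} (ρ : SymW n) (π : Equiv.Perm (Fin n)) (I : Fin n → Fin 4) :
    pauliCoeff (I ∘ ⇑π) (ρ : Op n) = pauliCoeff I (ρ : Op n) := by
  have h := expect_comp_perm ρ π fun k => pauli (I k)
  rw [expect_apply, expect_apply, Matrix.trace_mul_comm, Matrix.trace_mul_comm (ρ : Op n)] at h
  exact congrArg (fun z : ℂ => (2 ^ n : ℝ)⁻¹ * z.re) h

/-- A symmetric operator is determined by its polynomial: multi-indices with the same monomial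
are permutations of one another, and the Pauli coefficient is the same at all of them. -/
theorem F_injective {n : ℕ} : Function.Injective (F n) := by
  rw [injective_iff_map_eq_zero]
  intro ρ hρ
  have h0 : polyMap n (ρ : Op n) = 0 := congrArg Subtype.val hρ
  have hc (I : Fin n → Fin 4) : pauliCoeff I (ρ : Op n) = 0 := by
    have h1 := congrArg (coeff (pauliDegree I)) h0
    have h2 : coeff (pauliDegree I) (polyMap n (ρ : Op n)) =
        ∑ J : Fin n → Fin 4, if pauliDegree J = pauliDegree I then
          2 ^ n * pauliCoeff I (ρ : Op n) else 0 := by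
      change coeff _ (∑ J : Fin n → Fin 4, (2 ^ n * pauliCoeff J (ρ : Op n)) • pauliMonomial J) = _
      rw [coeff_sum]
      refine Finset.sum_congr rfl fun J _ => ?_
      rw [coeff_smul, pauliMonomial_eq, coeff_monomial]
      split_ifs with h
      · obtain ⟨π, rfl⟩ := exists_perm_of_card_eq (card_eq_of_pauliDegree_eq h)
        rw [pauliCoeff_comp_perm, smul_eq_mul, mul_one]
      · simp
    rw [h2, ← Finset.sum_filter, Finset.sum_const, coeff_zero, nsmul_eq_mul] at h1
    have h3 : (Finset.univ.filter fun J : Fin n → Fin 4 => pauliDegree J = pauliDegree I).card ≠ 0 :=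
      Finset.card_ne_zero.mpr ⟨I, by simp⟩
    simpa [h3] using h1
  apply Subtype.ext
  rw [pauli_expansion ρ.2.1]
  simp [hc]

theorem pauliCombination_eq (v : Fin 3 → ℝ) :
    ∑ j, ((![1, v 0, v 1, v 2] : Fin 4 → ℝ) j : ℂ) • pauli j = 1 + bloch v := by
  rw [Fin.sum_univ_four]
  ext a b
  fin_cases a <;> fin_cases b <;> simp [pauli, bloch] <;> ring

/-- The value of `F n ρ` at `v` is the expectation of `(1 + v · σ)^{⊗ n}`. -/
theorem eval_F {n : ℕ} (ρ : SymW n) (v : Fin 3 → ℝ) :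
    eval v (F n ρ : MvPolynomial (Fin 3) ℝ) = (expect (ρ : Op n) fun _ => 1 + bloch v).re := by
  rw [← pauliCombination_eq, MultilinearMap.map_sum]
  change eval v (∑ I : Fin n → Fin 4, (2 ^ n * pauliCoeff I (ρ : Op n)) • pauliMonomial I) = _
  rw [map_sum, Complex.re_sum]
  refine Finset.sum_congr rfl fun I _ => ?_
  rw [MultilinearMap.map_smul_univ, expect_apply, smul_eval, pauliMonomial, map_prod,
    pauliCoeff, Matrix.trace_mul_comm, smul_eq_mul, ← Complex.ofReal_prod, Complex.re_ofReal_mul,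
    mul_inv_cancel_left₀ (by positivity), mul_comm]
  congr 1
  refine Finset.prod_congr rfl fun k _ => ?_
  generalize I k = j
  fin_cases j <;> simp

theorem IsWerner.expect_conj {n : ℕ} {ρ : Op n} (h : IsWerner ρ)
    {g : Matrix (Fin 2) (Fin 2) ℂ} (hg : g ∈ specialUnitaryGroup (Fin 2) ℂ)
    (A : Fin n → Matrix (Fin 2) (Fin 2) ℂ) :
    expect ρ (fun k => g * A k * gᴴ) = expect ρ A := by
  have hg' : gᴴ ∈ specialUnitaryGroup (Fin 2) ℂ := by
    rw [mem_specialUnitaryGroup_iff] at hg ⊢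
    exact ⟨Unitary.star_mem hg.1, by rw [Matrix.det_conjTranspose, hg.2, star_one]⟩
  have h1 := h _ hg'
  have h2 := SymWerner.expect_conj ρ (fun _ => gᴴ) A
  rw [tensor_conjTranspose, h1] at h2
  simpa using h2.symm

theorem tensor_conj_mem {n : ℕ} (ρ : SymW n) (g : Matrix (Fin 2) (Fin 2) ℂ) :
    tensor (fun _ => g) * (ρ : Op n) * (tensor fun _ => g)ᴴ ∈ SymW n := by
  refine ⟨?_, fun π => ?_⟩
  · rw [Matrix.IsHermitian, Matrix.conjTranspose_mul, Matrix.conjTranspose_mul, ρ.2.1.eq,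
      Matrix.conjTranspose_conjTranspose, Matrix.mul_assoc]
  · have h (π : Equiv.Perm (Fin n)) (A : Matrix (Fin 2) (Fin 2) ℂ) :
        permOp π * tensor (fun _ : Fin n => A) = tensor (fun _ : Fin n => A) * permOp π := by
      have h1 := congrArg (· * permOp π) (permOp_conj_tensor π fun _ => A)
      simp only [Matrix.mul_assoc, permOp_inv_mul_permOp, Matrix.mul_one] at h1
      exact h1
    have h' (A : Matrix (Fin 2) (Fin 2) ℂ) : tensor (fun _ : Fin n => A) * (permOp π)⁻¹ =
        (permOp π)⁻¹ * tensor (fun _ : Fin n => A) := by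
      rw [permOp_inv, h]
    rw [tensor_conjTranspose]
    calc _ = (permOp π * tensor (fun _ : Fin n => g)) * ρ *
          (tensor (fun _ : Fin n => gᴴ) * (permOp π)⁻¹) := by simp only [Matrix.mul_assoc]
      _ = tensor (fun _ : Fin n => g) * (permOp π * ρ * (permOp π)⁻¹) *
          tensor (fun _ : Fin n => gᴴ) := by rw [h, h']; simp only [Matrix.mul_assoc]
      _ = _ := by rw [ρ.2.2 π]

/-! ### Werner states and polynomials in `x² + y² + z²` -/

/-- Rotating all qubits at once takes `v` to `(0, 0, r)`.  The functions `f k` commute with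
conjugation; they say which operator built from `v · σ` acts on the qubit `k`. -/
theorem IsWerner.expect_bloch_eq {n : ℕ} {ρ : Op n} (h : IsWerner ρ) {v : Fin 3 → ℝ} {r : ℝ}
    (hv : v ⬝ᵥ v = r ^ 2) (f : Fin n → Matrix (Fin 2) (Fin 2) ℂ → Matrix (Fin 2) (Fin 2) ℂ)
    (hf : ∀ k, ∀ g ∈ unitaryGroup (Fin 2) ℂ, ∀ A, g * f k A * gᴴ = f k (g * A * gᴴ)) :
    expect ρ (fun k => f k (bloch v)) = expect ρ (fun k => f k (bloch ![0, 0, r])) := by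
  obtain ⟨g, hg, hgv⟩ := exists_specialUnitary_bloch hv
  rw [← h.expect_conj hg]
  simp only [hf _ g (mem_specialUnitaryGroup_iff.mp hg).1, hgv]

theorem mul_one_add_mul_conjTranspose {g : Matrix (Fin 2) (Fin 2) ℂ}
    (hg : g ∈ unitaryGroup (Fin 2) ℂ) (A : Matrix (Fin 2) (Fin 2) ℂ) :
    g * (1 + A) * gᴴ = 1 + g * A * gᴴ := by
  have h : g * gᴴ = 1 := mem_unitaryGroup_iff.mp hg
  rw [mul_add, add_mul, mul_one, h]

/-- The polynomial of a Werner state is constant on spheres. -/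
theorem IsWerner.eval_F_eq {n : ℕ} {ρ : SymW n} (h : IsWerner (ρ : Op n)) {v : Fin 3 → ℝ}
    {r : ℝ} (hv : v ⬝ᵥ v = r ^ 2) :
    eval v (F n ρ : MvPolynomial (Fin 3) ℝ) = eval ![0, 0, r] (F n ρ).1 := by
  rw [eval_F, eval_F, h.expect_bloch_eq hv (fun _ A => 1 + A)
    fun _ g hg A => mul_one_add_mul_conjTranspose hg A]

theorem eval_sum_sq (b : ℕ → ℝ) (N : ℕ) (v : Fin 3 → ℝ) :
    eval v (∑ m ∈ Finset.range N,
      b m • (X 0 ^ 2 + X 1 ^ 2 + X 2 ^ 2 : MvPolynomial (Fin 3) ℝ) ^ m) =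
      ∑ m ∈ Finset.range N, b m * (v ⬝ᵥ v) ^ m := by
  simp [map_sum, smul_eval, dotProduct, Fin.sum_univ_three, sq]

theorem sum_range_two_mul (f : ℕ → ℝ) (N : ℕ) :
    ∑ i ∈ Finset.range (2 * N), f i = ∑ m ∈ Finset.range N, (f (2 * m) + f (2 * m + 1)) := by
  induction N with
  | zero => simp
  | succ N ih =>
    rw [show 2 * (N + 1) = 2 * N + 1 + 1 by ring, Finset.sum_range_succ, Finset.sum_range_succ, ih,
      Finset.sum_range_succ, add_assoc]

/-- A polynomial of degree at most `n` that is constant on spheres is a polynomial in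
`x² + y² + z²`: its restriction to the third axis is even, because `(0, 0, r)` and `(0, 0, -r)`
lie on the same sphere. -/
theorem exists_eq_sum_of_eval_eq {n : ℕ} {p : MvPolynomial (Fin 3) ℝ} (hdeg : p.totalDegree ≤ n)
    (h : ∀ (v : Fin 3 → ℝ) (r : ℝ), v ⬝ᵥ v = r ^ 2 → eval v p = eval ![0, 0, r] p) :
    ∃ b : ℕ → ℝ, p = ∑ m ∈ Finset.range (n / 2 + 1), b m • (X 0 ^ 2 + X 1 ^ 2 + X 2 ^ 2) ^ m := by
  set q : Polynomial ℝ := aeval ![0, 0, Polynomial.X] p with hq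
  have hqe (r : ℝ) : q.eval r = eval ![0, 0, r] p := by
    have h1 : (Polynomial.aeval r).comp (aeval ![0, 0, Polynomial.X]) =
        (aeval ![0, 0, r] : MvPolynomial (Fin 3) ℝ →ₐ[ℝ] ℝ) := by
      ext i
      fin_cases i <;> simp
    have h2 := DFunLike.congr_fun h1 p
    simpa [hq, Polynomial.coe_aeval_eq_eval, aeval_eq_eval] using h2
  have hqd : q.natDegree ≤ n := by
    have := aeval_natDegree_le p hdeg (![0, 0, Polynomial.X] : Fin 3 → Polynomial ℝ) (n := 1)
      (fun i => by fin_cases i <;> simp)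
    simpa using this
  have hqn : q.comp (Polynomial.C (-1) * Polynomial.X) = q := by
    refine Polynomial.funext fun r => ?_
    rw [Polynomial.eval_comp, Polynomial.eval_mul, Polynomial.eval_C, Polynomial.eval_X, hqe, hqe]
    exact (h _ _ (by simp [dotProduct, Fin.sum_univ_three, sq])).symm
  have hodd (m : ℕ) : q.coeff (2 * m + 1) = 0 := by
    have h1 := congrArg (fun q => Polynomial.coeff q (2 * m + 1)) hqn
    simp only [Polynomial.comp_C_mul_X_coeff] at h1
    have h2 : (-1 : ℝ) ^ (2 * m + 1) = -1 := by simp [pow_succ, pow_mul]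
    rw [h2] at h1
    linarith
  refine ⟨fun m => q.coeff (2 * m), MvPolynomial.funext fun v => ?_⟩
  have h0 : 0 ≤ v ⬝ᵥ v := Finset.sum_nonneg fun _ _ => mul_self_nonneg _
  rw [h v √(v ⬝ᵥ v) (Real.sq_sqrt h0).symm, ← hqe, eval_sum_sq,
    Polynomial.eval_eq_sum_range' (n := 2 * (n / 2 + 1)) (by omega), sum_range_two_mul]
  refine Finset.sum_congr rfl fun m _ => ?_
  rw [hodd, zero_mul, add_zero, pow_mul, Real.sq_sqrt h0]

theorem isWerner_iff_exists {n : ℕ} (ρ : SymW n) :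
    IsWerner (ρ : Op n) ↔ ∃ b : ℕ → ℝ, (F n ρ : MvPolynomial (Fin 3) ℝ) =
      ∑ m ∈ Finset.range (n / 2 + 1), b m • (X 0 ^ 2 + X 1 ^ 2 + X 2 ^ 2) ^ m := by
  refine ⟨fun h => exists_eq_sum_of_eval_eq ((mem_restrictTotalDegree _ _ _).mp (F n ρ).2)
    fun v r hv => h.eval_F_eq hv, ?_⟩
  rintro ⟨b, hb⟩ g hg
  have hg' : gᴴ ∈ unitaryGroup (Fin 2) ℂ := Unitary.star_mem (mem_specialUnitaryGroup_iff.mp hg).1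
  have hF : F n ⟨_, tensor_conj_mem ρ g⟩ = F n ρ := by
    refine Subtype.ext (MvPolynomial.funext fun v => ?_)
    obtain ⟨w, hw⟩ := exists_bloch_conj hg' v
    have hww := dotProduct_of_bloch_conj hg' hw hw
    have h1 := mul_one_add_mul_conjTranspose hg' (bloch v)
    rw [hw] at h1
    rw [Matrix.conjTranspose_conjTranspose] at h1
    rw [eval_F, SymWerner.expect_conj]
    simp only [h1]
    rw [← eval_F, hb, eval_sum_sq, eval_sum_sq, hww]
  have := congrArg Subtype.val (F_injective hF)
  rwa [← tensor_conjTranspose]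

end

/-! ### Correlations of Werner states -/

/-- The expectation of `σ_z` on the qubits in `S`. -/
noncomputable def expectZ {n : ℕ} (ρ : Op n) (S : Finset (Fin n)) : ℂ :=
  expect ρ (S.piecewise (fun _ => bloch ![0, 0, 1]) fun _ => 1)

theorem IsWerner.expect_piecewise_bloch {n : ℕ} {ρ : Op n} (h : IsWerner ρ) (S : Finset (Fin n))
    {v : Fin 3 → ℝ} {r : ℝ} (hv : v ⬝ᵥ v = r ^ 2) :
    expect ρ (S.piecewise (fun _ => bloch v) fun _ => 1) = (r : ℂ) ^ S.card * expectZ ρ S := by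
  have h1 := h.expect_bloch_eq hv (fun k A => if k ∈ S then A else 1) fun k g hg A => by
    split_ifs
    · rfl
    · rw [mul_one]
      exact mem_unitaryGroup_iff.mp hg
  have h2 : bloch ![0, 0, r] = (r : ℂ) • bloch ![0, 0, 1] := by
    rw [← bloch_smul]
    simp
  have h3 := (expect ρ).map_piecewise_smul (fun _ => (r : ℂ))
    (S.piecewise (fun _ => bloch ![0, 0, 1]) fun _ => 1) S
  rw [Finset.prod_const, smul_eq_mul] at h3
  refine Eq.trans h1 (Eq.trans ?_ h3)
  congr 1
  ext1 k
  by_cases hk : k ∈ S <;> simp [hk, h2]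

theorem IsWerner.expectZ_of_odd {n : ℕ} {ρ : Op n} (h : IsWerner ρ) {S : Finset (Fin n)}
    (hS : Odd S.card) : expectZ ρ S = 0 := by
  have h1 := h.expect_piecewise_bloch S (v := ![0, 0, 1]) (r := -1)
    (by simp [dotProduct, Fin.sum_univ_three])
  rw [Complex.ofReal_neg, Complex.ofReal_one, hS.neg_one_pow, neg_one_mul] at h1
  exact self_eq_neg.mp h1

theorem IsWerner.expect_piecewise_bloch_of_card {n : ℕ} {ρ : Op n} (h : IsWerner ρ)
    {S : Finset (Fin n)} {m : ℕ} (hS : S.card = 2 * m) (v : Fin 3 → ℝ) :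
    expect ρ (S.piecewise (fun _ => bloch v) fun _ => 1) =
      ((v ⬝ᵥ v : ℝ) : ℂ) ^ m * expectZ ρ S := by
  have h0 : 0 ≤ v ⬝ᵥ v := Finset.sum_nonneg fun _ _ => mul_self_nonneg _
  rw [h.expect_piecewise_bloch S (Real.sq_sqrt h0).symm, hS, pow_mul, ← Complex.ofReal_pow,
    Real.sq_sqrt h0]

/-- For a symmetric operator, the expectation of a product of at most three different factors
depends only on the number of qubits that carry each of them. -/
theorem expect_piecewise_congr {n : ℕ} (ρ : SymW n) {s t s' t' : Finset (Fin n)} (hs : s ⊆ t)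
    (hs' : s' ⊆ t') (hc : s.card = s'.card) (ht : t.card = t'.card)
    (A B C : Matrix (Fin 2) (Fin 2) ℂ) :
    expect (ρ : Op n) (s.piecewise (fun _ => A) (t.piecewise (fun _ => B) fun _ => C)) =
      expect (ρ : Op n) (s'.piecewise (fun _ => A) (t'.piecewise (fun _ => B) fun _ => C)) := by
  let f (s t : Finset (Fin n)) (k : Fin n) : Fin 3 := if k ∈ s then 0 else if k ∈ t then 1 else 2
  have hf (s t : Finset (Fin n)) :
      s.piecewise (fun _ => A) (t.piecewise (fun _ => B) fun _ => C) = ![A, B, C] ∘ f s t := by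
    ext1 k
    by_cases h1 : k ∈ s <;> by_cases h2 : k ∈ t <;> simp [f, h1, h2]
  have h0 (s t : Finset (Fin n)) : Fintype.card {k // f s t k = 0} = s.card := by
    rw [Fintype.card_subtype]
    congr 1
    ext k
    by_cases h1 : k ∈ s <;> by_cases h2 : k ∈ t <;> simp [f, h1, h2]
  have h1 {s t : Finset (Fin n)} (h : s ⊆ t) :
      Fintype.card {k // f s t k = 1} = t.card - s.card := by
    rw [Fintype.card_subtype, ← Finset.card_sdiff_of_subset h]
    congr 1
    ext k
    by_cases h1 : k ∈ s <;> by_cases h2 : k ∈ t <;> simp [f, h1, h2]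
  have h2 {s t : Finset (Fin n)} (h : s ⊆ t) :
      Fintype.card {k // f s t k = 2} = n - t.card := by
    have hn := Finset.card_compl t
    rw [Fintype.card_fin] at hn
    rw [Fintype.card_subtype, ← hn]
    congr 1
    ext k
    by_cases h1 : k ∈ s
    · simp [f, h1, h h1]
    · by_cases h2 : k ∈ t <;> simp [f, h1, h2]
  obtain ⟨π, hπ⟩ := exists_perm_of_card_eq (f := f s t) (g := f s' t') (by
    intro c
    fin_cases c
    · exact (h0 s t).trans (hc.trans (h0 s' t').symm)
    · exact (h1 hs).trans (by rw [hc, ht]; exact (h1 hs').symm)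
    · exact (h2 hs).trans (by rw [ht]; exact (h2 hs').symm))
  rw [hf, hf, ← hπ, ← Function.comp_assoc, expect_comp_perm]

theorem expectZ_congr {n : ℕ} (ρ : SymW n) {S T : Finset (Fin n)} (h : S.card = T.card) :
    expectZ (ρ : Op n) S = expectZ (ρ : Op n) T := by
  simpa [expectZ] using expect_piecewise_congr ρ (Finset.empty_subset S) (Finset.empty_subset T)
    rfl h 1 (bloch ![0, 0, 1]) 1

open Polynomial in
theorem coeff_quadratic_pow (p r : ℂ) (m : ℕ) :
    ((1 + C (2 * p) * X + C r * X ^ 2 : ℂ[X]) ^ m).coeff 2 = m * (r + 2 * (m - 1) * p ^ 2) := by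
  have h0 (m : ℕ) : ((1 + C (2 * p) * X + C r * X ^ 2 : ℂ[X]) ^ m).coeff 0 = 1 := by
    simp [coeff_zero_eq_eval_zero]
  have hs (m : ℕ) : (1 + C (2 * p) * X + C r * X ^ 2 : ℂ[X]) ^ (m + 1) =
      (1 + C (2 * p) * X + C r * X ^ 2) ^ m +
        C (2 * p) * ((1 + C (2 * p) * X + C r * X ^ 2) ^ m * X) +
        C r * ((1 + C (2 * p) * X + C r * X ^ 2) ^ m * X ^ 2) := by
    ring
  have h1 (m : ℕ) : ((1 + C (2 * p) * X + C r * X ^ 2 : ℂ[X]) ^ m).coeff 1 = 2 * m * p := by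
    induction m with
    | zero => simp [coeff_one]
    | succ m ih =>
      rw [hs, coeff_add, coeff_add, coeff_C_mul, coeff_C_mul, coeff_mul_X, ih, h0,
        coeff_mul_X_pow']
      simp
      ring
  induction m with
  | zero => simp [coeff_one]
  | succ m ih =>
    rw [hs, coeff_add, coeff_add, coeff_C_mul, coeff_C_mul, coeff_mul_X, ih, h1,
      coeff_mul_X_pow', if_pos le_rfl, Nat.sub_self, h0]
    push_cast
    ring

theorem expect_piecewise_add_smul {n : ℕ} (ρ : Op n) (S : Finset (Fin n)) (v y : Fin 3 → ℝ)
    (b : ℝ) :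
    expect ρ (S.piecewise (fun _ => bloch (v + b • y)) fun _ => 1) =
      ∑ t ∈ S.powerset, (b : ℂ) ^ t.card *
        expect ρ (t.piecewise (fun _ => bloch y) (S.piecewise (fun _ => bloch v) fun _ => 1)) := by
  set N : Fin n → Matrix (Fin 2) (Fin 2) ℂ := S.piecewise (fun _ => bloch v) fun _ => 1 with hN
  have h1 : S.piecewise (fun _ => bloch (v + b • y)) (fun _ => 1) =
      S.piecewise ((fun _ => (b : ℂ) • bloch y) + N) N := by
    ext1 k
    by_cases hk : k ∈ S <;> simp [hN, hk, bloch_add, bloch_smul, add_comm]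
  rw [h1, MultilinearMap.map_piecewise_add]
  refine Finset.sum_congr rfl fun t _ => ?_
  have h2 := (expect ρ).map_piecewise_smul (fun _ => (b : ℂ))
    (t.piecewise (fun _ => bloch y) N) t
  rw [Finset.prod_const, smul_eq_mul] at h2
  rw [← h2]
  congr 1
  ext1 k
  by_cases hk : k ∈ t <;> simp [hk]

/-- The second-order term in `b` of the identity
`⟨((v + b y) · σ)^{⊗ 2m}⟩ = |v + b y|^{2m} ⟨σ_z^{⊗ 2m}⟩`. -/
theorem IsWerner.expect_two_same {n : ℕ} {ρ : SymW n} (h : IsWerner (ρ : Op n))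
    {S t : Finset (Fin n)} {m : ℕ} (hm : m ≠ 0) (hS : S.card = 2 * m) (ht : t ⊆ S)
    (ht2 : t.card = 2) {v : Fin 3 → ℝ} (hv : v ⬝ᵥ v = 1) (y : Fin 3 → ℝ) :
    (2 * m - 1) * expect (ρ : Op n)
        (t.piecewise (fun _ => bloch y) (S.piecewise (fun _ => bloch v) fun _ => 1)) =
      expectZ (ρ : Op n) S *
        (((y ⬝ᵥ y : ℝ) : ℂ) + (2 * m - 2) * ((v ⬝ᵥ y : ℝ) : ℂ) ^ 2) := by
  set E : Finset (Fin n) → ℂ := fun t => expect (ρ : Op n)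
    (t.piecewise (fun _ => bloch y) (S.piecewise (fun _ => bloch v) fun _ => 1)) with hE
  have hpoly : ∑ t ∈ S.powerset, Polynomial.C (E t) * Polynomial.X ^ t.card =
      Polynomial.C (expectZ (ρ : Op n) S) * (1 + Polynomial.C (2 * ((v ⬝ᵥ y : ℝ) : ℂ)) *
        Polynomial.X + Polynomial.C ((y ⬝ᵥ y : ℝ) : ℂ) * Polynomial.X ^ 2) ^ m := by
    refine Polynomial.eq_of_infinite_eval_eq _ _
      ((Set.infinite_range_of_injective Complex.ofReal_injective).mono ?_)
    rintro _ ⟨b, rfl⟩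
    have h1 := expect_piecewise_add_smul (ρ : Op n) S v y b
    rw [h.expect_piecewise_bloch_of_card hS] at h1
    have h2 : (v + b • y) ⬝ᵥ (v + b • y) = 1 + 2 * (v ⬝ᵥ y) * b + y ⬝ᵥ y * b ^ 2 := by
      rw [← hv]
      simp only [dotProduct, Fin.sum_univ_three, Pi.add_apply, Pi.smul_apply, smul_eq_mul]
      ring
    rw [h2] at h1
    push_cast at h1
    simp only [Set.mem_ofPred_eq, Polynomial.eval_finsetSum, Polynomial.eval_mul,
      Polynomial.eval_C, Polynomial.eval_pow, Polynomial.eval_X, Polynomial.eval_add,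
      Polynomial.eval_one]
    rw [mul_comm (expectZ _ _), h1]
    exact Finset.sum_congr rfl fun _ _ => mul_comm _ _
  have h1 := congrArg (fun q => Polynomial.coeff q 2) hpoly
  simp only [Polynomial.finsetSum_coeff, Polynomial.coeff_C_mul, coeff_quadratic_pow,
    Polynomial.coeff_X_pow, mul_ite, mul_one, mul_zero] at h1
  rw [← Finset.sum_filter] at h1
  have h2 : ∀ s ∈ S.powerset.filter fun s => 2 = s.card, E s = E t := by
    intro s hs
    rw [Finset.mem_filter, Finset.mem_powerset] at hs
    exact expect_piecewise_congr ρ hs.1 ht (hs.2.symm.trans ht2.symm) rfl _ _ _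
  have h3 : (S.powerset.filter fun s => 2 = s.card) = S.powersetCard 2 := by
    ext s
    simp [Finset.mem_powersetCard, eq_comm]
  rw [Finset.sum_congr rfl h2, Finset.sum_const, h3, Finset.card_powersetCard, hS, nsmul_eq_mul,
    Nat.cast_choose_two] at h1
  have hm' : (m : ℂ) ≠ 0 := Nat.cast_ne_zero.mpr hm
  push_cast at h1
  apply mul_left_cancel₀ hm'
  linear_combination h1

theorem piecewise_pair_eq_update {ι α : Type*} [DecidableEq ι] (i j : ι) (a : α) (f : ι → α) :
    ({i, j} : Finset ι).piecewise (fun _ => a) f =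
      Function.update (Function.update f i a) j a := by
  ext1 k
  by_cases hi : k = i <;> by_cases hj : k = j <;> simp [Function.update_apply, hi, hj]

/-- Polarization of `IsWerner.expect_two_same`: the correlation of `x · σ` and `y · σ` on two
qubits, with `v · σ` measured on `2m - 2` further ones. -/
theorem IsWerner.expect_two {n : ℕ} {ρ : SymW n} (h : IsWerner (ρ : Op n))
    {S : Finset (Fin n)} {m : ℕ} (hm : m ≠ 0) (hS : S.card = 2 * m) {i j : Fin n} (hij : i ≠ j)
    (hi : i ∈ S) (hj : j ∈ S) {v : Fin 3 → ℝ} (hv : v ⬝ᵥ v = 1) (x y : Fin 3 → ℝ) :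
    (2 * m - 1) * expect (ρ : Op n) (Function.update (Function.update
        (S.piecewise (fun _ => bloch v) fun _ => 1) i (bloch x)) j (bloch y)) =
      expectZ (ρ : Op n) S * (((x ⬝ᵥ y : ℝ) : ℂ) +
        (2 * m - 2) * (((v ⬝ᵥ x : ℝ) : ℂ) * ((v ⬝ᵥ y : ℝ) : ℂ))) := by
  set N : Fin n → Matrix (Fin 2) (Fin 2) ℂ := S.piecewise (fun _ => bloch v) fun _ => 1 with hN
  set E : Matrix (Fin 2) (Fin 2) ℂ → Matrix (Fin 2) (Fin 2) ℂ → ℂ := fun A B =>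
    expect (ρ : Op n) (Function.update (Function.update N i A) j B) with hE
  have hadd_right (A B B') : E A (B + B') = E A B + E A B' := by
    simp only [hE, MultilinearMap.map_update_add]
  have hsymm (A B) : E A B = E B A := by
    simp only [hE]
    rw [← expect_comp_perm ρ (Equiv.swap i j)]
    congr 1
    ext1 k
    rcases eq_or_ne k i with rfl | hki
    · simp [hij]
    rcases eq_or_ne k j with rfl | hkj
    · simp [hij]
    simp [Equiv.swap_apply_of_ne_of_ne hki hkj, hki, hkj]
  have hadd_left (A A' B) : E (A + A') B = E A B + E A' B := by
    rw [hsymm, hadd_right, hsymm, hsymm B]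
  have hdiag (x : Fin 3 → ℝ) : (2 * m - 1) * E (bloch x) (bloch x) = expectZ (ρ : Op n) S *
      (((x ⬝ᵥ x : ℝ) : ℂ) + (2 * m - 2) * ((v ⬝ᵥ x : ℝ) : ℂ) ^ 2) := by
    have := h.expect_two_same hm hS (t := {i, j}) (by simp [Finset.insert_subset_iff, hi, hj])
      (Finset.card_pair hij) hv x
    rwa [piecewise_pair_eq_update] at this
  have h1 := hdiag (x + y)
  have h2 : (x + y) ⬝ᵥ (x + y) = x ⬝ᵥ x + 2 * (x ⬝ᵥ y) + y ⬝ᵥ y := by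
    rw [add_dotProduct, dotProduct_add, dotProduct_add, dotProduct_comm y x]
    ring
  rw [bloch_add, hadd_left, hadd_right, hadd_right, hsymm (bloch y) (bloch x), h2,
    dotProduct_add] at h1
  push_cast at h1
  linear_combination (h1 - hdiag x - hdiag y) / 2

/-! ### Local unitary equivalence -/

theorem coe_symPauli_zero {n : ℕ} :
    (symPauli (fun _ : Fin n => (0 : Fin 4)) : Op n) = (2 ^ n : ℝ)⁻¹ • (1 : Op n) := by
  have h1 : pauliTensor (fun _ : Fin n => (0 : Fin 4)) = 1 := by
    rw [← tensor_one, pauliTensor]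
    congr 1
    ext1 k
    exact Matrix.one_fin_two.symm
  have h2 : sym (1 : Op n) = 1 :=
    sym_eq_self ⟨1, Matrix.isHermitian_one, fun π => by
      rw [Matrix.mul_one, permOp_inv, permOp_mul_permOp_inv]⟩
  change (2 ^ n : ℝ)⁻¹ • sym (pauliTensor _) = _
  rw [h1, h2]

/-- A symmetric Werner state without correlations is maximally mixed, because its polynomial
is `1`. -/
theorem IsWerner.eq_of_expectZ_eq_zero {n : ℕ} {ρ : SymW n} (h : IsWerner (ρ : Op n))
    (htr : (ρ : Op n).trace = 1) (h0 : ∀ S : Finset (Fin n), S.Nonempty → expectZ (ρ : Op n) S = 0) :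
    (ρ : Op n) = (2 ^ n : ℝ)⁻¹ • (1 : Op n) := by
  have hF : F n ρ = F n (symPauli fun _ => 0) := by
    refine Subtype.ext (MvPolynomial.funext fun v => ?_)
    have hv : 0 ≤ v ⬝ᵥ v := Finset.sum_nonneg fun _ _ => mul_self_nonneg _
    have h1 := (expect (ρ : Op n)).map_add_univ (fun _ => bloch v) fun _ => 1
    rw [Finset.sum_eq_single ∅] at h1
    · have h2 : (fun _ : Fin n => 1 + bloch v) = (fun _ => bloch v) + fun _ => 1 :=
        funext fun _ => add_comm _ _
      rw [eval_F, F_symPauli, h2, h1, Finset.piecewise_empty, expect_apply, tensor_one,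
        Matrix.mul_one, htr]
      simp [pauliMonomial]
    · intro S _ hS
      rw [h.expect_piecewise_bloch S (Real.sq_sqrt hv).symm,
        h0 S (Finset.nonempty_iff_ne_empty.mpr hS), mul_zero]
    · simp
  rw [F_injective hF, coe_symPauli_zero]

theorem conjTranspose_mul_mem_unitaryGroup {g g' : Matrix (Fin 2) (Fin 2) ℂ}
    (hg : g ∈ unitaryGroup (Fin 2) ℂ) (hg' : g' ∈ unitaryGroup (Fin 2) ℂ) :
    gᴴ * g' ∈ unitaryGroup (Fin 2) ℂ :=
  mul_mem (Unitary.star_mem hg) hg'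

section

variable {n : ℕ} {ρ ρ' : SymW n} {g : Fin n → Matrix (Fin 2) (Fin 2) ℂ}

/-- Two-qubit correlations: `ρ` and `ρ'` have correlation tensors `c x · y` and `c' x · y`, so the
rotations by `g i` and `g j` differ by a scalar. -/
theorem exists_smul_of_card_eq_two (hρ : IsWerner (ρ : Op n)) (hρ' : IsWerner (ρ' : Op n))
    (hg : ∀ k, g k ∈ unitaryGroup (Fin 2) ℂ)
    (h : tensor g * (ρ : Op n) * (tensor g)ᴴ = ρ') {S : Finset (Fin n)} (hS : S.card = 2)
    (h0 : expectZ (ρ : Op n) S ≠ 0) {i j : Fin n} (hij : i ≠ j) (hi : i ∈ S) (hj : j ∈ S) :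
    ∃ ε : ℂ, ∀ v, (g i)ᴴ * g j * bloch v * ((g i)ᴴ * g j)ᴴ = ε • bloch v := by
  have hgg (k) : g k * (g k)ᴴ = 1 := mem_unitaryGroup_iff.mp (hg k)
  have hgg' (k) : (g k)ᴴ * g k = 1 := mem_unitaryGroup_iff'.mp (hg k)
  obtain rfl : {i, j} = S := Finset.eq_of_subset_of_card_le
    (by simp [Finset.insert_subset_iff, hi, hj]) (by rw [hS, Finset.card_pair hij])
  have hone : (![0, 0, 1] : Fin 3 → ℝ) ⬝ᵥ ![0, 0, 1] = 1 := by
    simp [dotProduct, Fin.sum_univ_three]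
  set N : Fin n → Matrix (Fin 2) (Fin 2) ℂ :=
    ({i, j} : Finset (Fin n)).piecewise (fun _ => bloch ![0, 0, 1]) fun _ => 1 with hN
  have key {x y x' y' : Fin 3 → ℝ} (hx : g i * bloch x * (g i)ᴴ = bloch x')
      (hy : g j * bloch y * (g j)ᴴ = bloch y') :
      expectZ (ρ' : Op n) {i, j} * ((x' ⬝ᵥ y' : ℝ) : ℂ) =
        expectZ (ρ : Op n) {i, j} * ((x ⬝ᵥ y : ℝ) : ℂ) := by
    have h1 := hρ.expect_two one_ne_zero hS hij hi hj hone x y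
    have h2 := hρ'.expect_two one_ne_zero hS hij hi hj hone x' y'
    rw [← hN] at h1 h2
    have h3 : expect (ρ' : Op n) (Function.update (Function.update N i (bloch x')) j (bloch y')) =
        expect (ρ : Op n) (Function.update (Function.update N i (bloch x)) j (bloch y)) := by
      rw [← h, expect_conj]
      congr 1
      ext1 k
      rcases eq_or_ne k j with rfl | hkj
      · rw [Function.update_self, Function.update_self, ← hy]
        simp only [← Matrix.mul_assoc, hgg', Matrix.one_mul]
        rw [Matrix.mul_assoc, hgg', Matrix.mul_one]
      rcases eq_or_ne k i with rfl | hki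
      · rw [Function.update_of_ne hkj, Function.update_of_ne hkj, Function.update_self,
          Function.update_self, ← hx]
        simp only [← Matrix.mul_assoc, hgg', Matrix.one_mul]
        rw [Matrix.mul_assoc, hgg', Matrix.mul_one]
      · simp [hkj, hki, hN, hgg']
    rw [h3] at h2
    push_cast at h1 h2
    linear_combination h1 - h2
  set c := expectZ (ρ : Op n) {i, j}
  set c' := expectZ (ρ' : Op n) {i, j}
  have hA := conjTranspose_mul_mem_unitaryGroup (hg i) (hg j)
  have key' {y z : Fin 3 → ℝ} (hz : (g i)ᴴ * g j * bloch y * ((g i)ᴴ * g j)ᴴ = bloch z)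
      (x : Fin 3 → ℝ) : c' * ((x ⬝ᵥ z : ℝ) : ℂ) = c * ((x ⬝ᵥ y : ℝ) : ℂ) := by
    obtain ⟨x', hx⟩ := exists_bloch_conj (hg i) x
    obtain ⟨z', hz'⟩ := exists_bloch_conj (hg i) z
    have hy : g j * bloch y * (g j)ᴴ = bloch z' := by
      rw [← hz', ← hz, Matrix.conjTranspose_mul, Matrix.conjTranspose_conjTranspose]
      simp only [← Matrix.mul_assoc, hgg, Matrix.one_mul]
      simp only [Matrix.mul_assoc, hgg, Matrix.mul_one]
    rw [← key hx hy, dotProduct_of_bloch_conj (hg i) hx hz']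
  have hc' : c' ≠ 0 := by
    intro hc'
    obtain ⟨z, hz⟩ := exists_bloch_conj hA ![0, 0, 1]
    have := key' hz ![0, 0, 1]
    rw [hone, hc'] at this
    simp at this
    exact h0 this.symm
  refine ⟨c / c', fun y => ?_⟩
  obtain ⟨z, hz⟩ := exists_bloch_conj hA y
  have hk (k : Fin 3) : (z k : ℂ) = c / c' * y k := by
    have := key' hz (Pi.single k 1)
    rw [single_one_dotProduct, single_one_dotProduct] at this
    field_simp
    linear_combination this
  rw [hz]
  ext a b
  fin_cases a <;> fin_cases b <;> simp [bloch, hk] <;> ring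

/-- Correlations of `2m ≥ 4` qubits.  As `ρ'` is invariant under the exchange of the qubits
`i` and `j`, the state `ρ` is invariant under the rotation `R` by `(g i)† (g j)` on the one and its
inverse on the other.  By `IsWerner.expect_two` this yields
`R v · R⁻¹ v + (2m - 2) (v · R v)² = 2m - 1` for all unit vectors `v`, whence `(v · R v)² = 1`. -/
theorem exists_smul_of_two_lt_card (hρ : IsWerner (ρ : Op n))
    (hg : ∀ k, g k ∈ unitaryGroup (Fin 2) ℂ)
    (h : tensor g * (ρ : Op n) * (tensor g)ᴴ = ρ') {S : Finset (Fin n)} {m : ℕ}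
    (hm : 2 ≤ m) (hS : S.card = 2 * m)
    (h0 : expectZ (ρ : Op n) S ≠ 0) {i j : Fin n} (hij : i ≠ j) (hi : i ∈ S) (hj : j ∈ S) :
    ∃ ε : ℂ, ∀ v, (g i)ᴴ * g j * bloch v * ((g i)ᴴ * g j)ᴴ = ε • bloch v := by
  have hgg (k) : g k * (g k)ᴴ = 1 := mem_unitaryGroup_iff.mp (hg k)
  have hgg' (k) : (g k)ᴴ * g k = 1 := mem_unitaryGroup_iff'.mp (hg k)
  have hA := conjTranspose_mul_mem_unitaryGroup (hg i) (hg j)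
  have hA' := conjTranspose_mul_mem_unitaryGroup (hg j) (hg i)
  refine exists_smul_of_forall_bloch_conj fun v hv => ?_
  obtain ⟨x, hx⟩ := exists_bloch_conj hA v
  obtain ⟨y, hy⟩ := exists_bloch_conj hA' v
  have hxx : x ⬝ᵥ x = 1 := (dotProduct_of_bloch_conj hA hx hx).trans hv
  have hyy : y ⬝ᵥ y = 1 := (dotProduct_of_bloch_conj hA' hy hy).trans hv
  have hAy : (g i)ᴴ * g j * bloch y * ((g i)ᴴ * g j)ᴴ = bloch v := by
    rw [← hy]
    simp only [Matrix.conjTranspose_mul, Matrix.conjTranspose_conjTranspose]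
    calc _ = (g i)ᴴ * (g j * (g j)ᴴ) * g i * bloch v * ((g i)ᴴ * (g j * (g j)ᴴ) * g i) := by
          simp only [Matrix.mul_assoc]
      _ = _ := by rw [hgg, Matrix.mul_one, hgg', Matrix.one_mul, Matrix.mul_one]
  have hvy : v ⬝ᵥ y = v ⬝ᵥ x := by
    rw [← dotProduct_of_bloch_conj hA hx hAy, dotProduct_comm]
  set N : Fin n → Matrix (Fin 2) (Fin 2) ℂ := S.piecewise (fun _ => bloch v) fun _ => 1 with hN
  have h1 : expect (ρ : Op n) (Function.update (Function.update N i (bloch x)) j (bloch y)) =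
      expect (ρ : Op n) N := by
    have h2 := expect_comp_perm ρ' (Equiv.swap i j) fun k => g k * N k * (g k)ᴴ
    rw [← h, expect_conj, expect_conj] at h2
    have h3 : (fun k => (g k)ᴴ * (g k * N k * (g k)ᴴ) * g k) = N := by
      ext1 k
      simp only [← Matrix.mul_assoc, hgg', Matrix.one_mul]
      rw [Matrix.mul_assoc, hgg', Matrix.mul_one]
    rw [h3] at h2
    rw [← h2]
    congr 1
    ext1 k
    rcases eq_or_ne k j with rfl | hkj
    · rw [Function.update_self, ← hy, Function.comp_apply, Equiv.swap_apply_right,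
        show N i = bloch v from Finset.piecewise_eq_of_mem _ _ _ hi]
      simp [Matrix.mul_assoc]
    rcases eq_or_ne k i with rfl | hki
    · rw [Function.update_of_ne hkj, Function.update_self, ← hx, Function.comp_apply,
        Equiv.swap_apply_left, show N j = bloch v from Finset.piecewise_eq_of_mem _ _ _ hj]
      simp [Matrix.mul_assoc]
    · rw [Function.update_of_ne hkj, Function.update_of_ne hki, Function.comp_apply,
        Equiv.swap_apply_of_ne_of_ne hki hkj]
      exact (congrFun h3 k).symm
  have h2 := hρ.expect_two (by omega) hS hij hi hj hv x y
  rw [← hN, h1, hN, hρ.expect_piecewise_bloch_of_card hS, hv, hvy] at h2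
  have h3 : (2 * m - 1 : ℝ) = x ⬝ᵥ y + (2 * m - 2) * ((v ⬝ᵥ x) * (v ⬝ᵥ x)) := by
    have h4 : (2 * m - 1 : ℂ) = ((x ⬝ᵥ y : ℝ) : ℂ) +
        (2 * m - 2) * (((v ⬝ᵥ x : ℝ) : ℂ) * ((v ⬝ᵥ x : ℝ) : ℂ)) := by
      apply mul_left_cancel₀ h0
      rw [← h2]
      simp
      ring
    exact_mod_cast h4
  -- Since `x ⬝ᵥ y ≤ 1`, the equation forces `(v ⬝ᵥ x)² ≥ 1`, the case of equality in the
  -- Cauchy-Schwarz inequality for the unit vectors `v` and `x`.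
  have hxy : 0 ≤ (x - y) ⬝ᵥ (x - y) := Finset.sum_nonneg fun _ _ => mul_self_nonneg _
  rw [sub_dotProduct, dotProduct_sub, dotProduct_sub, hxx, hyy, dotProduct_comm y x] at hxy
  have hperp : (x - (v ⬝ᵥ x) • v) ⬝ᵥ (x - (v ⬝ᵥ x) • v) = 1 - (v ⬝ᵥ x) * (v ⬝ᵥ x) := by
    simp only [sub_dotProduct, dotProduct_sub, smul_dotProduct, dotProduct_smul, smul_eq_mul, hxx,
      hv, dotProduct_comm x v]
    ring
  have hpos : 0 ≤ (x - (v ⬝ᵥ x) • v) ⬝ᵥ (x - (v ⬝ᵥ x) • v) :=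
    Finset.sum_nonneg fun _ _ => mul_self_nonneg _
  have hm2 : (2 : ℝ) ≤ m := by exact_mod_cast hm
  have hzero : (x - (v ⬝ᵥ x) • v) ⬝ᵥ (x - (v ⬝ᵥ x) • v) = 0 := by
    rw [hperp] at hpos ⊢
    nlinarith
  exact ⟨v ⬝ᵥ x,
    hx.trans (congrArg bloch (sub_eq_zero.mp (dotProduct_self_eq_zero.mp hzero)))⟩

/-- A local unitary between symmetric Werner states, the first of which is correlated, has all its
factors equal up to scalars. -/
theorem exists_eq_smul_of_expectZ_ne_zero (hρ : IsWerner (ρ : Op n)) (hρ' : IsWerner (ρ' : Op n))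
    (hg : ∀ k, g k ∈ unitaryGroup (Fin 2) ℂ)
    (h : tensor g * (ρ : Op n) * (tensor g)ᴴ = ρ') {S : Finset (Fin n)} (hS : S.Nonempty)
    (h0 : expectZ (ρ : Op n) S ≠ 0) (i j : Fin n) : ∃ z : ℂ, g j = z • g i := by
  rcases eq_or_ne i j with rfl | hij
  · exact ⟨1, (one_smul _ _).symm⟩
  obtain ⟨m, hm⟩ : Even S.card := by
    by_contra hodd
    exact h0 (hρ.expectZ_of_odd (Nat.not_even_iff_odd.mp hodd))
  have hpos := hS.card_pos
  obtain ⟨T, hT, hTS⟩ := Finset.exists_superset_card_eq (s := {i, j}) (n := S.card)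
    (by rw [Finset.card_pair hij]; omega) (Finset.card_le_univ S)
  rw [expectZ_congr ρ hTS.symm] at h0
  have hi : i ∈ T := hT (by simp)
  have hj : j ∈ T := hT (by simp)
  have hA : ∃ ε : ℂ, ∀ v, (g i)ᴴ * g j * bloch v * ((g i)ᴴ * g j)ᴴ = ε • bloch v := by
    rcases Nat.lt_or_ge m 2 with hm2 | hm2
    · exact exists_smul_of_card_eq_two hρ hρ' hg h (by omega) h0 hij hi hj
    · exact exists_smul_of_two_lt_card hρ hg h hm2 (by omega) h0 hij hi hj
  obtain ⟨ε, hε⟩ := hA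
  obtain ⟨z, hz⟩ :=
    eq_smul_one_of_bloch_conj (conjTranspose_mul_mem_unitaryGroup (hg i) (hg j)) hε
  refine ⟨z, ?_⟩
  have h1 := congrArg (fun M => g i * M) hz
  have hgg : g i * (g i)ᴴ = 1 := mem_unitaryGroup_iff.mp (hg i)
  simpa only [← Matrix.mul_assoc, hgg, Matrix.one_mul, mul_smul_comm, Matrix.mul_one] using h1

end

/-- Every unitary `2 × 2` matrix is a scalar multiple of an element of `SU(2)`. -/
theorem exists_smul_specialUnitary {g : Matrix (Fin 2) (Fin 2) ℂ}
    (hg : g ∈ unitaryGroup (Fin 2) ℂ) :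
    ∃ u : ℂ, ∃ a ∈ specialUnitaryGroup (Fin 2) ℂ, g = u • a := by
  have hd : star g.det * g.det = 1 := by
    rw [← Matrix.det_conjTranspose, ← Matrix.det_mul]
    rw [show gᴴ * g = 1 from mem_unitaryGroup_iff'.mp hg, Matrix.det_one]
  have hd0 : g.det ≠ 0 := right_ne_zero_of_mul_eq_one hd
  obtain ⟨u, hu⟩ := IsAlgClosed.exists_pow_nat_eq g.det two_pos
  have hu0 : u ≠ 0 := by
    rintro rfl
    exact hd0 (by rw [← hu]; simp)
  have hun : ‖u‖ = 1 := by
    have h1 := congrArg norm hd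
    rw [← hu, norm_mul, norm_star, norm_one, norm_pow, ← pow_add] at h1
    exact (pow_eq_one_iff_of_nonneg (norm_nonneg u) (by norm_num)).mp h1
  have huu : u⁻¹ * star u⁻¹ = 1 := by
    rw [Complex.star_def, Complex.mul_conj, Complex.normSq_eq_norm_sq, norm_inv, hun]
    simp
  refine ⟨u, u⁻¹ • g, mem_specialUnitaryGroup_iff.mpr ⟨mem_unitaryGroup_iff.mpr ?_, ?_⟩, ?_⟩
  · rw [star_smul, smul_mul_smul_comm, huu, mem_unitaryGroup_iff.mp hg, one_smul]
  · rw [Matrix.det_smul, ← hu]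
    simp [hu0]
  · rw [smul_smul, mul_inv_cancel₀ hu0, one_smul]

/-- Local unitarily equivalent symmetric Werner states are equal. -/
theorem IsWerner.eq_of_local_unitary {n : ℕ} {ρ ρ' : SymW n} (hρ : IsWerner (ρ : Op n))
    (hρ' : IsWerner (ρ' : Op n)) (htr : (ρ : Op n).trace = 1) (htr' : (ρ' : Op n).trace = 1)
    {g : Fin n → Matrix (Fin 2) (Fin 2) ℂ} (hg : ∀ k, g k ∈ unitaryGroup (Fin 2) ℂ)
    (h : tensor g * (ρ : Op n) * (tensor g)ᴴ = ρ') : ρ = ρ' := by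
  apply Subtype.ext
  by_cases hS : ∃ S : Finset (Fin n), S.Nonempty ∧ expectZ (ρ : Op n) S ≠ 0
  · obtain ⟨S, hS, h0⟩ := hS
    obtain ⟨i, -⟩ := id hS
    obtain ⟨u, a, ha, hu⟩ := exists_smul_specialUnitary (hg i)
    choose z hz using exists_eq_smul_of_expectZ_ne_zero hρ hρ' hg h hS h0 i
    have hga : g = fun k => (z k * u) • a := funext fun k => by rw [hz, hu, smul_smul]
    have hW := hρ a ha
    rw [← tensor_conjTranspose] at hW
    have h1 : ∃ c : ℂ, (ρ' : Op n) = c • (ρ : Op n) := by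
      refine ⟨(∏ k, z k * u) * star (∏ k, z k * u), ?_⟩
      rw [← h, hga, tensor_smul, Matrix.conjTranspose_smul, smul_mul_assoc, smul_mul_smul_comm,
        hW]
    obtain ⟨c, hc⟩ := h1
    have h2 := congrArg Matrix.trace hc
    rw [Matrix.trace_smul, htr, htr', smul_eq_mul, mul_one] at h2
    rw [hc, ← h2, one_smul]
  · push Not at hS
    have hone : tensor g * (tensor g)ᴴ = 1 := by
      rw [tensor_conjTranspose, tensor_mul_tensor, ← tensor_one]
      exact congrArg tensor (funext fun k => mem_unitaryGroup_iff.mp (hg k))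
    rw [← h, hρ.eq_of_expectZ_eq_zero htr hS, mul_smul_comm, smul_mul_assoc, Matrix.mul_one, hone]

end SymWerner

theorem theorem1 (n : ℕ) :
    (∀ ρ : SymWerner.SymW n, SymWerner.IsDensityMatrix (ρ : SymWerner.Op n) →
      (SymWerner.IsWerner (ρ : SymWerner.Op n) ↔
        ∃ b : ℕ → ℝ, (SymWerner.F n ρ : MvPolynomial (Fin 3) ℝ) =
          ∑ m ∈ Finset.range (n / 2 + 1),
            b m • (MvPolynomial.X 0 ^ 2 + MvPolynomial.X 1 ^ 2 + MvPolynomial.X 2 ^ 2) ^ m)) ∧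
    (∀ ρ ρ' : SymWerner.SymW n,
      SymWerner.IsDensityMatrix (ρ : SymWerner.Op n) →
      SymWerner.IsDensityMatrix (ρ' : SymWerner.Op n) →
      SymWerner.IsWerner (ρ : SymWerner.Op n) → SymWerner.IsWerner (ρ' : SymWerner.Op n) →
      ∀ g : Fin n → Matrix (Fin 2) (Fin 2) ℂ,
        (∀ k, g k ∈ Matrix.unitaryGroup (Fin 2) ℂ) →
        SymWerner.tensor g * (ρ : SymWerner.Op n) * (SymWerner.tensor g).conjTranspose = ρ' →
        ρ = ρ') := by
  refine ⟨fun ρ _ => SymWerner.isWerner_iff_exists ρ, ?_⟩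
  intro ρ ρ' hd hd' hρ hρ' g hg h
  exact hρ.eq_of_local_unitary hρ' hd.2 hd'.2 hg h
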